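/- Let $F$ be a non-archimedean locally compact field with residue field of characteristic $p$, and let $k$ be an algebraically closed field of characteristic $\ell \neq p$ ($\ell = 0$ is allowed). Let $\mathrm{M}$ be a Levi subgroup of $\mathrm{GL}_n(F)$ (possibly $\mathrm{GL}_n(F)$ itself) and put $\mathrm{M}' = \mathrm{M} \cap \mathrm{SL}_n(F)$. All $k$-representations are smooth. An irreducible $k$-representation $\pi$ of $\mathrm{H} = \mathrm{M}$ or $\mathrm{M}'$ is called cuspidal if, for every proper Levi subgroup $\mathrm{L}$ of $\mathrm{H}$, every parabolic subgroup of $\mathrm{H}$ with Levi factor $\mathrm{L}$, and every irreducible $k$-representation $\rho$ of $\mathrm{L}$, $\pi$ is isomorphic neither to a subrepresentation nor to a quotient of the representation of $\mathrm{H}$ parabolically induced from $\rho$. A $k$-quasicharacter of $F^\times$ is a homomorphism $F^\times \to k^\times$ with open kernel. Let $\pi'$ be an irreducible cuspidal $k$-representation of $\mathrm{M}'$, and let $\pi_1, \pi_2$ be irreducible cuspidal $k$-representations of $\mathrm{M}$ such that $\pi'$ is isomorphic to a direct summand of each of the restrictions $\mathrm{res}^{\mathrm{M}}_{\mathrm{M}'}\pi_1$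 and $\mathrm{res}^{\mathrm{M}}_{\mathrm{M}'}\pi_2$. Then there exists a $k$-quasicharacter $\chi$ of $F^\times$ such that $\pi_1 \cong \pi_2 \otimes (\chi \circ \det)$. -/

import Mathlib

open scoped MatrixGroups

namespace ModularSLn

open Matrix

section Groups

variable {n : ℕ} {F : Type*} [Field F]

/-- A cocharacter `λ : 𝔾ₘ → GLₙ` defined over `F`, written as
`λ(t) = x · diag(t ^ d₁, …, t ^ dₙ) · x⁻¹`. Every cocharacter of `GLₙ` over `F` has this form. -/
structure Cocharacter (n : ℕ) (F : Type*) [Field F] where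
  /-- the change of basis diagonalising the cocharacter -/
  x : GL (Fin n) F
  /-- the weights -/
  d : Fin n → ℤ

/-- The invertible diagonal matrix with diagonal entries `t ^ d i`. -/
def diagGL (d : Fin n → ℤ) (t : Fˣ) : GL (Fin n) F where
  val := Matrix.diagonal fun i => ((t ^ d i : Fˣ) : F)
  inv := Matrix.diagonal fun i => ((t ^ (-d i) : Fˣ) : F)
  val_inv := by
    rw [Matrix.diagonal_mul_diagonal, ← Matrix.diagonal_one]
    congr 1; funext i
    rw [← Units.val_mul, ← _root_.zpow_add, add_neg_cancel, zpow_zero, Units.val_one]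
  inv_val := by
    rw [Matrix.diagonal_mul_diagonal, ← Matrix.diagonal_one]
    congr 1; funext i
    rw [← Units.val_mul, ← _root_.zpow_add, neg_add_cancel, zpow_zero, Units.val_one]

namespace Cocharacter

/-- The value `λ(t) ∈ GLₙ(F)` for `t ∈ Fˣ`. -/
def eval (l : Cocharacter n F) (t : Fˣ) : GL (Fin n) F := l.x * diagGL l.d t * l.x⁻¹

/-- The matrix of `g` in the basis that diagonalises `λ`. -/
def coords (l : Cocharacter n F) (g : GL (Fin n) F) : Matrix (Fin n) (Fin n) F :=
  ((l.x⁻¹ * g * l.x : GL (Fin n) F) : Matrix (Fin n) (Fin n) F)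

theorem coords_one (l : Cocharacter n F) : l.coords 1 = 1 := by
  simp [coords]

theorem coords_mul (l : Cocharacter n F) (g h : GL (Fin n) F) :
    l.coords (g * h) = l.coords g * l.coords h := by
  rw [coords, coords, coords, ← Units.val_mul]
  congr 1
  group

theorem coords_inv_mul (l : Cocharacter n F) (g : GL (Fin n) F) :
    l.coords g⁻¹ * l.coords g = 1 := by
  rw [← coords_mul, inv_mul_cancel, coords_one]

theorem coords_inv (l : Cocharacter n F) (g : GL (Fin n) F) :
    l.coords g⁻¹ = (l.coords g)⁻¹ :=
  (Matrix.inv_eq_left_inv (l.coords_inv_mul g)).symm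

theorem blockTriangular_coords_inv (l : Cocharacter n F) {g : GL (Fin n) F} {d : Fin n → ℤ}
    (hg : (l.coords g).BlockTriangular d) : (l.coords g⁻¹).BlockTriangular d := by
  have : Invertible (l.coords g) := invertibleOfLeftInverse _ _ (l.coords_inv_mul g)
  rw [coords_inv]
  exact Matrix.blockTriangular_inv_of_blockTriangular hg

/-- The group of `F`-points of the parabolic subgroup of `GLₙ` attached to `λ`: the elements whose
matrix, in the basis diagonalising `λ`, is block triangular for the weights. It is the set of those
`g` for which `λ(t) g λ(t)⁻¹` has a limit for `t → ∞`. -/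
def parabolic (l : Cocharacter n F) : Subgroup (GL (Fin n) F) where
  carrier := {g | (l.coords g).BlockTriangular l.d}
  one_mem' := by
    change (l.coords 1).BlockTriangular l.d
    rw [coords_one]; exact Matrix.blockTriangular_one
  mul_mem' := by
    intro g h hg hh
    change (l.coords (g * h)).BlockTriangular l.d
    rw [coords_mul]; exact Matrix.BlockTriangular.mul hg hh
  inv_mem' := by
    intro g hg
    exact l.blockTriangular_coords_inv hg

/-- The opposite cocharacter `λ⁻¹`. -/
def opp (l : Cocharacter n F) : Cocharacter n F := ⟨l.x, fun i => -l.d i⟩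

/-- The Levi factor of `l.parabolic`: the intersection with the opposite parabolic subgroup, which
is the centraliser of `λ` in `GLₙ(F)`. -/
def levi (l : Cocharacter n F) : Subgroup (GL (Fin n) F) := l.parabolic ⊓ l.opp.parabolic

theorem mem_levi_iff (l : Cocharacter n F) (g : GL (Fin n) F) :
    g ∈ l.levi ↔ ∀ i j, l.d i ≠ l.d j → l.coords g i j = 0 := by
  constructor
  · rintro ⟨h₁, h₂⟩ i j hij
    rcases lt_or_gt_of_ne hij with h | h
    · exact h₂ (i := i) (j := j) (neg_lt_neg h)
    · exact h₁ h
  · intro h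
    exact ⟨fun i j hij => h i j (ne_of_gt hij),
      fun i j hij => h i j (ne_of_lt (neg_lt_neg_iff.mp hij))⟩

/-- The unipotent radical of `l.parabolic`: block triangular matrices, in the basis diagonalising
`λ`, whose diagonal blocks are identity matrices. -/
def unipotentRadical (l : Cocharacter n F) : Subgroup (GL (Fin n) F) where
  carrier := {g | (l.coords g).BlockTriangular l.d ∧
    ∀ i j, l.d i = l.d j → l.coords g i j = (1 : Matrix (Fin n) (Fin n) F) i j}
  one_mem' := by
    refine ⟨l.parabolic.one_mem, fun i j _ => ?_⟩
    rw [coords_one]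
  mul_mem' := by
    rintro g h ⟨hg, hg'⟩ ⟨hh, hh'⟩
    refine ⟨l.parabolic.mul_mem hg hh, fun i j hij => ?_⟩
    rw [coords_mul]
    have : (l.coords g * l.coords h) i j
        = ((1 : Matrix (Fin n) (Fin n) F) * l.coords h) i j := by
      rw [Matrix.mul_apply, Matrix.mul_apply]
      refine Finset.sum_congr rfl fun k _ => ?_
      rcases lt_trichotomy (l.d i) (l.d k) with hk | hk | hk
      · rw [hh (i := k) (j := j) (hij ▸ hk), mul_zero, mul_zero]
      · rw [hg' i k hk]
      · rw [hg hk, Matrix.one_apply_ne (fun e => by subst e; exact lt_irrefl _ hk)]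
    rw [this, Matrix.one_mul, hh' i j hij]
  inv_mem' := by
    rintro g ⟨hg, hg'⟩
    have hi : (l.coords g⁻¹).BlockTriangular l.d := l.blockTriangular_coords_inv hg
    refine ⟨hi, fun i j hij => ?_⟩
    have : (l.coords g⁻¹ * l.coords g) i j
        = (l.coords g⁻¹ * (1 : Matrix (Fin n) (Fin n) F)) i j := by
      rw [Matrix.mul_apply, Matrix.mul_apply]
      refine Finset.sum_congr rfl fun k _ => ?_
      rcases lt_trichotomy (l.d i) (l.d k) with hk | hk | hk
      · rw [hg (i := k) (j := j) (hij ▸ hk),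
          Matrix.one_apply_ne (fun e => by subst e; exact lt_irrefl _ (hij ▸ hk))]
      · rw [hg' k j (hk.symm.trans hij)]
      · rw [hi hk, zero_mul, zero_mul]
    rw [← Matrix.mul_one (l.coords g⁻¹), ← this, coords_inv_mul]

/-- `λ` takes its values in the subgroup `H` of `GLₙ(F)`. -/
def IsIn (l : Cocharacter n F) (H : Subgroup (GL (Fin n) F)) : Prop := ∀ t : Fˣ, l.eval t ∈ H

end Cocharacter

/-- `M` is (the group of `F`-points of) a Levi subgroup of `GLₙ`, that is, a Levi factor of a
parabolic subgroup of `GLₙ` defined over `F`: the stabiliser of each summand in a direct sum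
decomposition of `Fⁿ`. The case `M = GLₙ(F)` is included. -/
def IsLeviSubgroup (M : Subgroup (GL (Fin n) F)) : Prop := ∃ l : Cocharacter n F, M = l.levi

/-- `SLₙ(F)` as a subgroup of `GLₙ(F)`. -/
def SLsub (n : ℕ) (F : Type*) [Field F] : Subgroup (GL (Fin n) F) :=
  (Matrix.GeneralLinearGroup.det (n := Fin n) (R := F)).ker

/-- `M' = M ∩ SLₙ(F)`. -/
def prime (M : Subgroup (GL (Fin n) F)) : Subgroup (GL (Fin n) F) := M ⊓ SLsub n F

end Groups

section Representations

variable {k : Type*} [Field k]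

/-- A representation of a topological group is smooth if every vector has an open stabiliser. -/
def IsSmooth {G V : Type*} [Group G] [TopologicalSpace G] [AddCommGroup V] [Module k V]
    (π : Representation k G V) : Prop :=
  ∀ v : V, IsOpen {g : G | π g v = v}

variable {n : ℕ} {F : Type*} [Field F]

/-- The restriction of a representation of `M` to `M' = M ∩ SLₙ(F)`. -/
def resPrime {M : Subgroup (GL (Fin n) F)} {V : Type*} [AddCommGroup V] [Module k V]
    (π : Representation k M V) : Representation k (prime M) V :=
  π.comp (Subgroup.inclusion (inf_le_left : prime M ≤ M))

/-- `σ` is isomorphic to a direct summand of `τ`: it is a retract of `τ`. -/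
def IsDirectComponent {G V W : Type*} [Group G] [AddCommGroup V] [Module k V]
    [AddCommGroup W] [Module k W] (σ : Representation k G V) (τ : Representation k G W) : Prop :=
  ∃ (i : σ.IntertwiningMap τ) (r : τ.IntertwiningMap σ), ∀ v : V, r (i v) = v

/-- The twist `π ⊗ (χ ∘ det)`. -/
def twistDet {M : Subgroup (GL (Fin n) F)} {V : Type*} [AddCommGroup V] [Module k V]
    (π : Representation k M V) (χ : Fˣ →* kˣ) : Representation k M V where
  toFun g := ((χ (Matrix.GeneralLinearGroup.det (g : GL (Fin n) F)) : kˣ) : k) • π g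
  map_one' := by simp
  map_mul' a b := by
    ext v
    simp only [Subgroup.coe_mul, map_mul, Units.val_mul, LinearMap.smul_apply,
      Module.End.mul_apply, map_smul, mul_smul]
    exact smul_comm _ _ _

variable [TopologicalSpace F]

/-- A `k`-quasicharacter of `Fˣ`: a homomorphism `Fˣ → kˣ` with open kernel. -/
def IsQuasicharacter (χ : Fˣ →* kˣ) : Prop := IsOpen (χ.ker : Set Fˣ)

variable [IsTopologicalRing F]

/-- The space of the representation of `H` parabolically induced from the representation `ρ` of
the Levi subgroup `L = H ∩ λ.levi` along the parabolic subgroup `P = L U` with unipotent radical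
`U = H ∩ λ.unipotentRadical`: the functions `f : H → W` with `f (m u h) = ρ(m) f(h)` for `m ∈ L`,
`u ∈ U`, that are right invariant under some open subgroup of `H`. -/
def parabolicIndSpace (H : Subgroup (GL (Fin n) F)) (l : Cocharacter n F)
    {W : Type*} [AddCommGroup W] [Module k W]
    (ρ : Representation k ↥(H ⊓ l.levi) W) : Submodule k (H → W) where
  carrier := {f |
    (∀ (m : ↥(H ⊓ l.levi)) (h : H), f (Subgroup.inclusion inf_le_left m * h) = ρ m (f h)) ∧
    (∀ (u : ↥(H ⊓ l.unipotentRadical)) (h : H),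
      f (Subgroup.inclusion inf_le_left u * h) = f h) ∧
    ∃ K : Subgroup H, IsOpen (K : Set H) ∧ ∀ (h : H), ∀ κ ∈ K, f (h * κ) = f h}
  zero_mem' := ⟨fun m h => by simp, fun u h => rfl, ⊤, isOpen_univ, fun _ _ _ => rfl⟩
  add_mem' := by
    rintro f g ⟨hf₁, hf₂, K₁, hK₁, hf₃⟩ ⟨hg₁, hg₂, K₂, hK₂, hg₃⟩
    refine ⟨fun m h => ?_, fun u h => ?_, K₁ ⊓ K₂, ?_, fun h κ hκ => ?_⟩
    · simp [hf₁, hg₁]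
    · simp [hf₂, hg₂]
    · rw [Subgroup.coe_inf]; exact hK₁.inter hK₂
    · simp [hf₃ h κ hκ.1, hg₃ h κ hκ.2]
  smul_mem' := by
    rintro c f ⟨hf₁, hf₂, K, hK, hf₃⟩
    refine ⟨fun m h => ?_, fun u h => ?_, K, hK, fun h κ hκ => ?_⟩
    · simp [hf₁]
    · simp [hf₂]
    · simp [hf₃ h κ hκ]

/-- The parabolically induced representation: `H` acts on `parabolicIndSpace` by right
translation, `(h · f)(y) = f (y h)`. -/
def parabolicInd (H : Subgroup (GL (Fin n) F)) (l : Cocharacter n F)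
    {W : Type*} [AddCommGroup W] [Module k W]
    (ρ : Representation k ↥(H ⊓ l.levi) W) :
    Representation k H (parabolicIndSpace H l ρ) where
  toFun h :=
    { toFun := fun f => ⟨fun y => f.1 (y * h), by
        obtain ⟨f, hf₁, hf₂, K, hK, hf₃⟩ := f
        refine ⟨fun m y => ?_, fun u y => ?_, K.comap (MulAut.conj h⁻¹).toMonoidHom, ?_,
          fun y κ hκ => ?_⟩
        · simpa only [mul_assoc] using hf₁ m (y * h)
        · simpa only [mul_assoc] using hf₂ u (y * h)
        · have hc : Continuous fun y : H => h⁻¹ * y * h := by fun_prop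
          have := hK.preimage hc
          convert this using 1
          ext y
          simp
        · have h' : h⁻¹ * κ * h ∈ K := by simpa using hκ
          have := hf₃ (y * h) _ h'
          simpa [mul_assoc] using this⟩
      map_add' := fun _ _ => rfl
      map_smul' := fun _ _ => rfl }
  map_one' := by ext f y; simp
  map_mul' a b := by ext f y; simp [mul_assoc]

/-- Cuspidality of an irreducible smooth representation `π` of `H`, where `H` is a Levi subgroup of
`GLₙ(F)` or of `SLₙ(F)`: for every proper Levi subgroup `L` of `H`, every parabolic subgroup of `H`
with Levi factor `L`, and every irreducible smooth representation `ρ` of `L`, the representation `π`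
is neither a subrepresentation nor a quotient of the representation parabolically induced
from `ρ`.

The parabolic subgroups of `H` and their Levi factors are the `H ∩ λ.parabolic` and `H ∩ λ.levi`,
with `λ` running over the cocharacters of `H`. Induction is not normalised by the square root
of the modulus character: this square root is a smooth character of `L`, and twisting by it permutes
the irreducible smooth representations of `L`, so both normalisations give the same notion. As
`π ≠ 0`, its universe has room for all irreducible smooth representations of `L`, which have
countable dimension over `k`. -/
def IsCuspidal.{v, w, w'} {k : Type w'} [Field k] {n : ℕ} {F : Type w} [Field F]
    [TopologicalSpace F] [IsTopologicalRing F] {H : Subgroup (GL (Fin n) F)}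
    {V : Type v} [AddCommGroup V] [Module k V] (π : Representation k H V) : Prop :=
  ∀ l : Cocharacter n F, l.IsIn H → ¬ H ≤ l.levi →
    ∀ (W : Type v) [AddCommGroup W] [Module k W] (ρ : Representation k ↥(H ⊓ l.levi) W),
      ρ.IsIrreducible → IsSmooth ρ →
        (¬ ∃ f : π.IntertwiningMap (parabolicInd H l ρ), Function.Injective f) ∧
        (¬ ∃ f : (parabolicInd H l ρ).IntertwiningMap π, Function.Surjective f)

end Representations

end ModularSLn

/-! Composing a retraction of π₁ onto π' with an embedding of π' in π₂ gives a nonzero φ : V₁ → V₂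
commuting with M' (`exists_nonzero_intertwining`). Let M act on Hom(V₁, V₂) by g · f = π₂(g) f
π₁(g)⁻¹. On maps commuting with M' this action factors through det, so it is commutative. If the
orbit of φ spans a finite-dimensional space, that space contains a common eigenvector ψ
(`exists_common_eigenvector`), whose eigencharacter has the form χ₀ ∘ det. Then ψ intertwines π₁
with π₂ ⊗ (χ₀⁻¹ ∘ det), and it is bijective by irreducibility (`nonempty_equiv_twistDet`).

Finite dimension rests on two facts: φ is fixed by a congruence subgroup (`exists_leviCong_fix`),
and the scalar matrix of a uniformizer t acts by a scalar on V₁ and V₂, hence on Hom(V₁, V₂). Since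
Fˣ is finite modulo tⁿ and the units close to 1, the orbit of φ is finite up to scalars
(`exists_finite_orbit_reps`).

That t acts by a scalar is where cuspidality and ℓ ≠ p enter
(`IsCuspidal.exists_scalar_blockCenter`). The field k may be countable, so the cardinality proof of
Schur's lemma is not available. Instead, let Z be the group of diagonal matrices with one power of t
on each block, and let K be a congruence subgroup of positive level fixing some w₀ ≠ 0. The
coinvariants of K in V are nonzero, because the finite quotients of K have order invertible in k.
They are finitely generated over k[Z]: by the Cartan decomposition V is spanned by vectors κ₁
diag(tᵃ) κ₂ w₀ with κ₁, κ₂ integral, and when a varies too much inside a block, the vanishing of a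
Jacquet module kills the vector in the coinvariants. By the Nullstellensatz, a simple quotient over
k[Z] is one-dimensional. So for z in Z some π(z) - s has proper image; this image is a
subrepresentation, hence zero. -/

namespace ModularSLn

open Matrix ValuativeRel

/-! ### Fractional ideals and topology of a local field. -/

section LocalField

variable (F : Type*) [Field F] [ValuativeRel F] [TopologicalSpace F] [IsNonarchimedeanLocalField F]

/-- The normalised valuation of a local field. -/
noncomputable def ordVal : Valuation F (WithZero (Multiplicative ℤ)) :=
  (valuation F).map (IsNonarchimedeanLocalField.valueGroupWithZeroIsoInt F).toMonoidWithZeroHom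
    (IsNonarchimedeanLocalField.valueGroupWithZeroIsoInt F).strictMono.monotone

theorem ordVal_apply (x : F) :
    ordVal F x = IsNonarchimedeanLocalField.valueGroupWithZeroIsoInt F (valuation F x) := rfl

/-- The fractional ideal of the elements of valuation at least `m`. -/
noncomputable def fracIdeal (m : ℤ) : AddSubgroup F where
  carrier := {x | ordVal F x ≤ WithZero.exp (-m)}
  zero_mem' := by simp
  add_mem' := fun hx hy => (ordVal F).map_add_le hx hy
  neg_mem' := fun {x} hx => by simpa [Valuation.map_neg] using hx

variable {F}

theorem mem_fracIdeal {m : ℤ} {x : F} : x ∈ fracIdeal F m ↔ ordVal F x ≤ WithZero.exp (-m) :=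
  Iff.rfl

theorem mul_mem_fracIdeal {a b : ℤ} {x y : F} (hx : x ∈ fracIdeal F a) (hy : y ∈ fracIdeal F b) :
    x * y ∈ fracIdeal F (a + b) := by
  rw [mem_fracIdeal] at *
  rw [map_mul, neg_add, WithZero.exp_add]
  exact mul_le_mul' hx hy

theorem fracIdeal_anti {a b : ℤ} (h : a ≤ b) : fracIdeal F b ≤ fracIdeal F a := by
  intro x hx
  rw [mem_fracIdeal] at *
  exact hx.trans (WithZero.exp_le_exp.2 (by omega))

theorem one_mem_fracIdeal : (1 : F) ∈ fracIdeal F 0 := by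
  rw [mem_fracIdeal]; simp

theorem mul_mem_fracIdeal' {a b c : ℤ} {x y : F} (hx : x ∈ fracIdeal F a) (hy : y ∈ fracIdeal F b)
    (h : c ≤ a + b) : x * y ∈ fracIdeal F c :=
  fracIdeal_anti h (mul_mem_fracIdeal hx hy)

theorem exists_mem_fracIdeal (x : F) : ∃ m : ℕ, x ∈ fracIdeal F (-(m : ℤ)) := by
  obtain ⟨m, hm⟩ : ∃ m : ℤ, ordVal F x ≤ WithZero.exp m := ⟨_, WithZero.le_exp_log⟩
  refine ⟨m.toNat, ?_⟩
  rw [mem_fracIdeal, neg_neg]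
  exact hm.trans (WithZero.exp_le_exp.2 (Int.self_le_toNat m))

theorem exists_uniformizer : ∃ t : Fˣ, ordVal F (t : F) = WithZero.exp (-1) := by
  obtain ⟨x, hx⟩ := valuation_surjective
    ((IsNonarchimedeanLocalField.valueGroupWithZeroIsoInt F).symm (WithZero.exp (-1 : ℤ)))
  have h : ordVal F x = WithZero.exp (-1) := by
    rw [ordVal_apply, hx]; simp
  refine ⟨Units.mk0 x ?_, h⟩
  rintro rfl
  rw [map_zero] at h
  exact WithZero.exp_ne_zero h.symm

theorem ordVal_zpow {t : Fˣ} (ht : ordVal F (t : F) = WithZero.exp (-1)) (a : ℤ) :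
    ordVal F ((t ^ a : Fˣ) : F) = WithZero.exp (-a) := by
  rw [Units.val_zpow_eq_zpow_val, map_zpow₀, ht, ← WithZero.exp_zsmul]
  congr 1; simp

theorem zpow_mem_fracIdeal {t : Fˣ} (ht : ordVal F (t : F) = WithZero.exp (-1)) (a : ℤ) :
    ((t ^ a : Fˣ) : F) ∈ fracIdeal F a := by
  rw [mem_fracIdeal, ordVal_zpow ht]

theorem exists_eq_zpow_mul {t : Fˣ} (ht : ordVal F (t : F) = WithZero.exp (-1)) (x : Fˣ) :
    ∃ (a : ℤ) (u : Fˣ), x = t ^ a * u ∧ (u : F) ∈ fracIdeal F 0 ∧ ((u⁻¹ : Fˣ) : F) ∈ fracIdeal F 0 := by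
  have hx : ordVal F (x : F) ≠ 0 := by simp
  -- An element of order `a` has value `exp (-a)`, whence the sign of the exponent.
  refine ⟨-WithZero.log (ordVal F (x : F)), t ^ (WithZero.log (ordVal F (x : F))) * x, ?_, ?_, ?_⟩
  · rw [← mul_assoc, ← _root_.zpow_add]; simp
  · rw [mem_fracIdeal, Units.val_mul, map_mul, ordVal_zpow ht, WithZero.exp_neg, WithZero.exp_log hx,
      inv_mul_cancel₀ hx]; simp
  · rw [mem_fracIdeal, Units.val_inv_eq_inv_val, map_inv₀, Units.val_mul, map_mul, ordVal_zpow ht,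
      WithZero.exp_neg, WithZero.exp_log hx, inv_mul_cancel₀ hx]; simp

theorem div_mem_fracIdeal {x y : F} (h : ordVal F x ≤ ordVal F y) : x / y ∈ fracIdeal F 0 := by
  rw [mem_fracIdeal, map_div₀, neg_zero, WithZero.exp_zero]
  exact div_le_one_of_le₀ h zero_le

theorem isOpen_fracIdeal (m : ℤ) : IsOpen (fracIdeal F m : Set F) := by
  refine AddSubgroup.isOpen_of_mem_nhds _ (g := 0) ?_
  obtain ⟨t, ht⟩ := exists_uniformizer (F := F)
  refine ((IsValuativeTopology.hasBasis_nhds_zero' F).mem_iff).2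
    ⟨valuation F ((t ^ m : Fˣ) : F), (Valuation.ne_zero_iff _).2 (Units.ne_zero _), fun x hx => ?_⟩
  change ordVal F x ≤ _
  rw [← ordVal_zpow ht]
  exact (IsNonarchimedeanLocalField.valueGroupWithZeroIsoInt F).strictMono.monotone (le_of_lt hx)

theorem exists_fracIdeal_subset {s : Set F} (hs : s ∈ nhds (0 : F)) :
    ∃ m : ℕ, (fracIdeal F m : Set F) ⊆ s := by
  obtain ⟨γ, hγ, h⟩ := ((IsValuativeTopology.hasBasis_nhds_zero' F).mem_iff).1 hs
  obtain ⟨m, hm⟩ := WithZero.exists_exp_neg_natCast_lt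
    (x := IsNonarchimedeanLocalField.valueGroupWithZeroIsoInt F γ) (by simpa using hγ)
  refine ⟨m, fun x hx => h ?_⟩
  have : ordVal F x ≤ _ := hx
  exact (IsNonarchimedeanLocalField.valueGroupWithZeroIsoInt F).strictMono.lt_iff_lt.1
    (this.trans_lt hm)

theorem isCompact_fracIdeal_zero : IsCompact (fracIdeal F 0 : Set F) := by
  convert IsNonarchimedeanLocalField.isCompact_closedBall F 1 using 1
  ext x
  change ordVal F x ≤ _ ↔ valuation F x ≤ 1
  rw [neg_zero, WithZero.exp_zero, ← map_one (IsNonarchimedeanLocalField.valueGroupWithZeroIsoInt F)]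
  exact (IsNonarchimedeanLocalField.valueGroupWithZeroIsoInt F).strictMono.le_iff_le

/-- The compact ring of integers is covered by finitely many cosets of an open subgroup. -/
theorem exists_finset_fracIdeal (m : ℤ) :
    ∃ R : Finset F, ∀ x ∈ fracIdeal F 0, ∃ r ∈ R, x - r ∈ fracIdeal F m := by
  obtain ⟨R, -, hR⟩ := isCompact_fracIdeal_zero.elim_nhds_subcover
    (fun r : F => {x | x - r ∈ fracIdeal F m}) (fun r _ => by
      refine ((isOpen_fracIdeal m).preimage (f := fun x : F => x - r) (by fun_prop)).mem_nhds ?_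
      simp)
  refine ⟨R, fun x hx => ?_⟩
  obtain ⟨r, hr⟩ := Set.mem_iUnion.1 (hR hx)
  obtain ⟨h, hr⟩ := Set.mem_iUnion.1 hr
  exact ⟨r, h, hr⟩

/-- The value group is discrete: a nonzero value below `exp 0` is at most `exp (-1)`. -/
theorem lt_one_mem_fracIdeal {x : F} (hx : valuation F x < 1) : x ∈ fracIdeal F 1 := by
  have h := (IsNonarchimedeanLocalField.valueGroupWithZeroIsoInt F).strictMono hx
  rw [map_one, ← WithZero.exp_zero] at h
  rw [mem_fracIdeal]
  change ordVal F x < _ at h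
  by_cases h0 : ordVal F x = 0
  · simp [h0]
  · rw [← WithZero.exp_log h0, WithZero.exp_lt_exp] at h
    rw [← WithZero.exp_log h0, WithZero.exp_le_exp]; omega

theorem residueChar_mem_fracIdeal (p : ℕ)
    [CharP (IsLocalRing.ResidueField (valuation F).integer) p] : (p : F) ∈ fracIdeal F 1 := by
  apply lt_one_mem_fracIdeal
  have h : IsLocalRing.residue (valuation F).integer (p : (valuation F).integer) = 0 := by
    rw [map_natCast]; exact CharP.cast_eq_zero _ p
  rw [IsLocalRing.residue_eq_zero_iff, IsLocalRing.mem_maximalIdeal] at h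
  have h2 := (Valuation.integer.integers (valuation F)).isUnit_iff_valuation_eq_one
    (x := (p : (valuation F).integer))
  have h3 : valuation F (((p : (valuation F).integer)) : F) ≤ 1 := (p : (valuation F).integer).2
  rw [Subring.coe_natCast] at h3
  refine lt_of_le_of_ne h3 fun h4 => h (h2.2 ?_)
  simpa using h4

theorem residueChar_prime (p : ℕ)
    [CharP (IsLocalRing.ResidueField (valuation F).integer) p] : p.Prime := by
  have : Finite (IsLocalRing.ResidueField (valuation F).integer) :=
    inferInstanceAs (Finite 𝓀[F])
  exact (CharP.char_is_prime_or_zero (IsLocalRing.ResidueField (valuation F).integer) p).resolve_right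
    fun h => by
      subst h
      have := CharP.charP_to_charZero (IsLocalRing.ResidueField (valuation F).integer)
      exact not_finite (IsLocalRing.ResidueField (valuation F).integer)

end LocalField

/-! ### Principal congruence subgroups of the general linear group. -/

section Congruence

variable {F : Type*} [Field F] [ValuativeRel F] [TopologicalSpace F] [IsNonarchimedeanLocalField F]
  {n : ℕ}

theorem matMul_mem_fracIdeal {a b c : ℤ} {A B : Matrix (Fin n) (Fin n) F}
    (hA : ∀ i j, A i j ∈ fracIdeal F a) (hB : ∀ i j, B i j ∈ fracIdeal F b) (h : c ≤ a + b)
    (i j : Fin n) : (A * B) i j ∈ fracIdeal F c := by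
  rw [Matrix.mul_apply]
  exact sum_mem fun k _ => mul_mem_fracIdeal' (hA i k) (hB k j) h

theorem matOne_mem_fracIdeal (i j : Fin n) : (1 : Matrix (Fin n) (Fin n) F) i j ∈ fracIdeal F 0 := by
  rw [Matrix.one_apply]
  split_ifs
  · exact one_mem_fracIdeal
  · exact zero_mem _

variable (F n) in
/-- The principal congruence subgroup of level `m` of `GLₙ` of the ring of integers. -/
noncomputable def congSubgroup (m : ℕ) : Subgroup (GL (Fin n) F) where
  carrier := {g | (∀ i j, ((g : Matrix (Fin n) (Fin n) F) - 1) i j ∈ fracIdeal F m) ∧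
    ∀ i j, (((g⁻¹ : GL (Fin n) F) : Matrix (Fin n) (Fin n) F) - 1) i j ∈ fracIdeal F m}
  one_mem' := by simp [zero_mem]
  mul_mem' := by
    have key : ∀ A B : Matrix (Fin n) (Fin n) F, (∀ i j, (A - 1) i j ∈ fracIdeal F m) →
        (∀ i j, (B - 1) i j ∈ fracIdeal F m) → ∀ i j, (A * B - 1) i j ∈ fracIdeal F m := by
      intro A B hA hB i j
      have : A * B - 1 = (A - 1) * (B - 1) + (A - 1) + (B - 1) := by noncomm_ring
      rw [this]
      exact add_mem (add_mem (matMul_mem_fracIdeal hA hB (by omega) i j) (hA i j)) (hB i j)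
    rintro g h ⟨hg, hg'⟩ ⟨hh, hh'⟩
    refine ⟨?_, ?_⟩
    · rw [Units.val_mul]; exact key _ _ hg hh
    · rw [_root_.mul_inv_rev, Units.val_mul]; exact key _ _ hh' hg'
  inv_mem' := by
    rintro g ⟨hg, hg'⟩
    exact ⟨hg', by rwa [inv_inv]⟩

theorem mem_congSubgroup {m : ℕ} {g : GL (Fin n) F} : g ∈ congSubgroup F n m ↔
    (∀ i j, ((g : Matrix (Fin n) (Fin n) F) - 1) i j ∈ fracIdeal F m) ∧
    ∀ i j, (((g⁻¹ : GL (Fin n) F) : Matrix (Fin n) (Fin n) F) - 1) i j ∈ fracIdeal F m := Iff.rfl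

theorem mem_congSubgroup_zero {g : GL (Fin n) F} : g ∈ congSubgroup F n 0 ↔
    (∀ i j, (g : Matrix (Fin n) (Fin n) F) i j ∈ fracIdeal F 0) ∧
    ∀ i j, ((g⁻¹ : GL (Fin n) F) : Matrix (Fin n) (Fin n) F) i j ∈ fracIdeal F 0 := by
  have key : ∀ A : Matrix (Fin n) (Fin n) F,
      (∀ i j, (A - 1) i j ∈ fracIdeal F 0) ↔ ∀ i j, A i j ∈ fracIdeal F 0 := by
    intro A
    refine forall_congr' fun i => forall_congr' fun j => ?_
    rw [Matrix.sub_apply]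
    exact ⟨fun h => by simpa using add_mem h (matOne_mem_fracIdeal i j),
      fun h => sub_mem h (matOne_mem_fracIdeal i j)⟩
  rw [mem_congSubgroup, ← key g, ← key (g⁻¹ : GL (Fin n) F)]; rfl

theorem congSubgroup_anti {a b : ℕ} (h : a ≤ b) : congSubgroup F n b ≤ congSubgroup F n a :=
  fun _ hg => ⟨fun i j => fracIdeal_anti (by exact_mod_cast h) (hg.1 i j),
    fun i j => fracIdeal_anti (by exact_mod_cast h) (hg.2 i j)⟩

theorem conj_mem_congSubgroup {m : ℕ} {k g : GL (Fin n) F} (hk : k ∈ congSubgroup F n 0)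
    (hg : g ∈ congSubgroup F n m) : k * g * k⁻¹ ∈ congSubgroup F n m := by
  obtain ⟨hk, hk'⟩ := mem_congSubgroup_zero.1 hk
  have key : ∀ A : GL (Fin n) F,
      (∀ i j, ((A : Matrix (Fin n) (Fin n) F) - 1) i j ∈ fracIdeal F m) →
      ∀ i j, (((k * A * k⁻¹ : GL (Fin n) F) : Matrix (Fin n) (Fin n) F) - 1) i j ∈ fracIdeal F m := by
    intro A hA i j
    have : ((k * A * k⁻¹ : GL (Fin n) F) : Matrix (Fin n) (Fin n) F) - 1
        = k * ((A : Matrix (Fin n) (Fin n) F) - 1) * (k⁻¹ : GL (Fin n) F) := by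
      rw [mul_sub, sub_mul, mul_one, Units.mul_inv, Units.val_mul, Units.val_mul]
    rw [this]
    exact matMul_mem_fracIdeal (matMul_mem_fracIdeal hk hA le_rfl) hk' (by omega) i j
  refine ⟨key g hg.1, ?_⟩
  have : (k * g * k⁻¹)⁻¹ = k * g⁻¹ * k⁻¹ := by group
  rw [this]
  exact key g⁻¹ hg.2

/-- Factor A ^ p - 1 as (1 + A + ⋯ + A ^ (p - 1)) (A - 1). As m ≥ 1, each power of A is 1 modulo the
maximal ideal, so the first factor is p modulo that ideal, hence 0, and the level rises by one. -/
theorem pow_mem_congSubgroup {p : ℕ} (hp : (p : F) ∈ fracIdeal F 1) {m : ℕ} (hm : 1 ≤ m)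
    {g : GL (Fin n) F} (hg : g ∈ congSubgroup F n m) : g ^ p ∈ congSubgroup F n (m + 1) := by
  have key : ∀ A : GL (Fin n) F, A ∈ congSubgroup F n m →
      ∀ i j, (((A ^ p : GL (Fin n) F) : Matrix (Fin n) (Fin n) F) - 1) i j ∈
        fracIdeal F ((m + 1 : ℕ) : ℤ) := by
    intro A hA
    have h1 : ((A ^ p : GL (Fin n) F) : Matrix (Fin n) (Fin n) F) - 1
        = (∑ i ∈ Finset.range p, (A : Matrix (Fin n) (Fin n) F) ^ i) * (A - 1) := by
      rw [geom_sum_mul, Units.val_pow_eq_pow_val]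
    have h2 : ∀ i j, (∑ l ∈ Finset.range p, (A : Matrix (Fin n) (Fin n) F) ^ l) i j ∈
        fracIdeal F 1 := by
      intro i j
      have : (∑ l ∈ Finset.range p, (A : Matrix (Fin n) (Fin n) F) ^ l)
          = (∑ l ∈ Finset.range p, ((A : Matrix (Fin n) (Fin n) F) ^ l - 1))
            + (p : Matrix (Fin n) (Fin n) F) := by
        simp
      rw [this, Matrix.add_apply, Matrix.sum_apply]
      refine add_mem (sum_mem fun l _ => ?_) ?_
      · have := (pow_mem hA l).1 i j
        rw [Units.val_pow_eq_pow_val] at this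
        exact fracIdeal_anti (by exact_mod_cast hm) this
      · rw [Matrix.natCast_apply]
        split_ifs
        · exact hp
        · simp [zero_mem]
    rw [h1]
    exact matMul_mem_fracIdeal h2 hA.1 (by push_cast; omega)
  refine ⟨key g hg, ?_⟩
  rw [← inv_pow]
  exact key g⁻¹ (inv_mem hg)

theorem pow_pow_mem_congSubgroup {p : ℕ} (hp : (p : F) ∈ fracIdeal F 1)
    {g : GL (Fin n) F} (hg : g ∈ congSubgroup F n 1) (m : ℕ) :
    g ^ p ^ m ∈ congSubgroup F n (m + 1) := by
  induction m with
  | zero => simpa using hg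
  | succ m ih =>
    rw [pow_succ, pow_mul]
    exact pow_mem_congSubgroup hp (by omega) ih

theorem inv_mul_mem_congSubgroup {m : ℕ} {g h : GL (Fin n) F} (hg : g ∈ congSubgroup F n 0)
    (hh : h ∈ congSubgroup F n 0)
    (H : ∀ i j, ((g : Matrix (Fin n) (Fin n) F) - h) i j ∈ fracIdeal F m) :
    g⁻¹ * h ∈ congSubgroup F n m := by
  obtain ⟨-, hg'⟩ := mem_congSubgroup_zero.1 hg
  obtain ⟨-, hh'⟩ := mem_congSubgroup_zero.1 hh
  constructor
  · have : ((g⁻¹ * h : GL (Fin n) F) : Matrix (Fin n) (Fin n) F) - 1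
        = (g⁻¹ : GL (Fin n) F) * ((h : Matrix (Fin n) (Fin n) F) - g) := by
      rw [mul_sub, Units.inv_mul, Units.val_mul]
    rw [this]
    refine matMul_mem_fracIdeal hg' (fun i j => ?_) (b := m) (by omega)
    rw [← neg_sub (g : Matrix (Fin n) (Fin n) F)]
    exact neg_mem (H i j)
  · have : (((g⁻¹ * h)⁻¹ : GL (Fin n) F) : Matrix (Fin n) (Fin n) F) - 1
        = (h⁻¹ : GL (Fin n) F) * ((g : Matrix (Fin n) (Fin n) F) - h) := by
      rw [_root_.mul_inv_rev, inv_inv, mul_sub, Units.inv_mul, Units.val_mul]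
    rw [this]
    exact matMul_mem_fracIdeal hh' H (by omega)

/-- The coset of an integral matrix is determined by its entries modulo the `m`-th power of the
maximal ideal, for which there are finitely many possibilities. -/
theorem relIndex_congSubgroup_ne_zero (m : ℕ) :
    (congSubgroup F n m).relIndex (congSubgroup F n 0) ≠ 0 := by
  obtain ⟨R, hR⟩ := exists_finset_fracIdeal (F := F) m
  choose! r hrR hr using hR
  let f : congSubgroup F n 0 → Fin n → Fin n → R := fun g i j =>
    ⟨r ((g : GL (Fin n) F) i j), hrR _ ((mem_congSubgroup_zero.1 g.2).1 i j)⟩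
  have hf : ∀ g h : congSubgroup F n 0, f g = f h →
      (QuotientGroup.mk g : congSubgroup F n 0 ⧸ (congSubgroup F n m).subgroupOf _)
        = QuotientGroup.mk h := by
    intro g h hgh
    rw [QuotientGroup.eq, Subgroup.mem_subgroupOf]
    refine inv_mul_mem_congSubgroup g.2 h.2 fun i j => ?_
    have h1 := hr _ ((mem_congSubgroup_zero.1 g.2).1 i j)
    have h2 := hr _ ((mem_congSubgroup_zero.1 h.2).1 i j)
    have h3 : r ((g : GL (Fin n) F) i j) = r ((h : GL (Fin n) F) i j) :=
      congrArg Subtype.val (congrFun (congrFun hgh i) j)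
    have := sub_mem h1 h2
    rw [h3] at this
    simpa using this
  have : Finite (congSubgroup F n 0 ⧸ (congSubgroup F n m).subgroupOf (congSubgroup F n 0)) := by
    refine Finite.of_injective (fun q => f q.out) fun a b hab => ?_
    rw [← QuotientGroup.out_eq' a, ← QuotientGroup.out_eq' b]
    exact hf _ _ hab
  exact Subgroup.index_ne_zero_of_finite

/-- The topology of a unit group is induced by g ↦ (g, g⁻¹). This is why the congruence subgroups
control the entries of both g and g⁻¹. -/
theorem exists_congSubgroup_subset {U : Set (GL (Fin n) F)} (hU : U ∈ nhds 1) :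
    ∃ m : ℕ, (congSubgroup F n m : Set (GL (Fin n) F)) ⊆ U := by
  rw [Units.isInducing_embedProduct.nhds_eq_comap, Filter.mem_comap] at hU
  obtain ⟨s, hs, hsU⟩ := hU
  rw [map_one, Prod.one_eq_mk, mem_nhds_prod_iff] at hs
  obtain ⟨A, hA, B, hB, hAB⟩ := hs
  have key : ∀ A ∈ nhds (1 : Matrix (Fin n) (Fin n) F), ∃ m : ℕ, ∀ X : Matrix (Fin n) (Fin n) F,
      (∀ i j, (X - 1) i j ∈ fracIdeal F m) → X ∈ A := by
    intro A hA
    have h1 : (fun X : Matrix (Fin n) (Fin n) F => X + 1) ⁻¹' A ∈ nhds 0 :=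
      (by fun_prop : Continuous fun X : Matrix (Fin n) (Fin n) F => X + 1).continuousAt
        (by simpa using hA)
    rw [show nhds (0 : Matrix (Fin n) (Fin n) F) = nhds (0 : Fin n → Fin n → F) from rfl,
      nhds_pi] at h1
    obtain ⟨I, hI, t, ht, hsub⟩ := Filter.mem_pi.1 h1
    have h2 : ∀ i, ∃ m : ℕ, ∀ y : Fin n → F, (∀ j, y j ∈ fracIdeal F m) → y ∈ t i := by
      intro i
      have h3 := ht i
      rw [nhds_pi] at h3
      obtain ⟨J, hJ, u, hu, hsub'⟩ := Filter.mem_pi.1 h3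
      choose m hm using fun j => exists_fracIdeal_subset (hu j)
      refine ⟨Finset.univ.sup m, fun y hy => hsub' fun j _ => hm j ?_⟩
      exact fracIdeal_anti (by exact_mod_cast Finset.le_sup (Finset.mem_univ j)) (hy j)
    choose m hm using h2
    refine ⟨Finset.univ.sup m, fun X hX => ?_⟩
    have : (X - 1) + 1 ∈ A := hsub fun i _ => hm i _ fun j =>
      fracIdeal_anti (by exact_mod_cast Finset.le_sup (Finset.mem_univ i)) (hX i j)
    simpa using this
  obtain ⟨a, ha⟩ := key A hA
  obtain ⟨b, hb⟩ := key (MulOpposite.op ⁻¹' B)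
    (MulOpposite.continuous_op.continuousAt (by simpa using hB))
  refine ⟨max a b, fun g hg => hsU (hAB ⟨ha _ fun i j => ?_, hb _ fun i j => ?_⟩)⟩
  · exact fracIdeal_anti (by exact_mod_cast le_max_left a b) (hg.1 i j)
  · exact fracIdeal_anti (by exact_mod_cast le_max_right a b) (hg.2 i j)

end Congruence

/-! ### Coinvariants, irreducible quotients and scalar action for abstract groups. -/

section Abstract

variable {k G V : Type*} [Field k] [Group G] [AddCommGroup V] [Module k V]

/-- The span of the vectors `π(g) w - w` for `g ∈ A`. -/
def augSpan (π : Representation k G V) (A : Set G) : Submodule k V :=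
  Submodule.span k {x | ∃ g ∈ A, ∃ w, π g w - w = x}

variable {π : Representation k G V}

theorem sub_mem_augSpan {A : Set G} {g : G} (hg : g ∈ A) (w : V) : π g w - w ∈ augSpan π A :=
  Submodule.subset_span ⟨g, hg, w, rfl⟩

theorem augSpan_mono {A B : Set G} (h : A ⊆ B) : augSpan π A ≤ augSpan π B :=
  Submodule.span_mono fun _ ⟨g, hg, w, e⟩ => ⟨g, h hg, w, e⟩

theorem augSpan_le {A : Set G} {X : Submodule k V} (h : ∀ g ∈ A, ∀ w, π g w - w ∈ X) :
    augSpan π A ≤ X :=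
  Submodule.span_le.2 fun _ ⟨g, hg, w, e⟩ => e ▸ h g hg w

theorem apply_mem_augSpan {A B : Set G} {h : G} (hAB : ∀ g ∈ A, h * g * h⁻¹ ∈ B) {v : V}
    (hv : v ∈ augSpan π A) : π h v ∈ augSpan π B := by
  have : augSpan π A ≤ (augSpan π B).comap (π h) := augSpan_le fun g hg w => by
    rw [Submodule.mem_comap, map_sub]
    have := sub_mem_augSpan (π := π) (hAB g hg) (π h w)
    rw [← Module.End.mul_apply, ← map_mul] at this ⊢
    simpa using this
  exact this hv

theorem apply_eq_of_inv_mul_fixed {a b : G} {w : V} (h : π (a⁻¹ * b) w = w) : π a w = π b w := by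
  conv_lhs => rw [← h]
  rw [← Module.End.mul_apply, ← map_mul, mul_inv_cancel_left]

/-- If the finite quotients of `K` have order invertible in `k`, a vector fixed by `K` with zero
image in the coinvariants of `K` vanishes. -/
theorem eq_zero_of_fixed_of_mem_augSpan (K : Subgroup G) (N : ℕ → Subgroup G) (hN : Antitone N)
    (hNK : ∀ m, ∀ g ∈ K, ∀ x ∈ N m, g * x * g⁻¹ ∈ N m)
    (hindex : ∀ m, ((N m).relIndex K : k) ≠ 0)
    (hsmooth : ∀ w, ∃ m, ∀ g ∈ N m, π g w = w) {v : V} (hfix : ∀ g ∈ K, π g v = v)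
    (hv : v ∈ augSpan π K) : v = 0 := by
  have hfin : ∀ m, Finite (K ⧸ (N m).subgroupOf K) := fun m =>
    Subgroup.index_ne_zero_iff_finite.1 fun h => hindex m (by rw [Subgroup.relIndex, h]; simp)
  let _ := fun m => Fintype.ofFinite (K ⧸ (N m).subgroupOf K)
  have hnormal : ∀ m, ((N m).subgroupOf K).Normal := fun m =>
    ⟨fun x hx g => hNK m g g.2 x hx⟩
  -- Summing over K / N m is independent of representatives only on vectors fixed by N m. Asking for
  -- all large m lets the claim pass to linear combinations.
  have key : ∃ m₀, ∀ m ≥ m₀, ∑ q : K ⧸ (N m).subgroupOf K, π (q.out : K) v = 0 := by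
    refine Submodule.span_induction ?_ ⟨0, by simp⟩ ?_ ?_ hv
    · rintro _ ⟨κ, hκ, w, rfl⟩
      obtain ⟨m₀, hm₀⟩ := hsmooth w
      refine ⟨m₀, fun m hm => ?_⟩
      simp only [map_sub, Finset.sum_sub_distrib, sub_eq_zero]
      -- Right translation by κ permutes the cosets, and the chosen representatives differ by
      -- elements of N m, which fix w.
      refine Fintype.sum_equiv (Equiv.mulRight (QuotientGroup.mk ⟨κ, hκ⟩)) _ _ fun q => ?_
      rw [← Module.End.mul_apply, ← map_mul]
      refine apply_eq_of_inv_mul_fixed (hm₀ _ (hN hm ?_))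
      have : (QuotientGroup.mk (q.out * ⟨κ, hκ⟩) : K ⧸ (N m).subgroupOf K)
          = QuotientGroup.mk ((Equiv.mulRight (QuotientGroup.mk ⟨κ, hκ⟩)) q).out := by
        rw [QuotientGroup.out_eq', QuotientGroup.mk_mul, QuotientGroup.out_eq']; rfl
      rw [QuotientGroup.eq, Subgroup.mem_subgroupOf] at this
      exact this
    · rintro x y - - ⟨a, ha⟩ ⟨b, hb⟩
      refine ⟨max a b, fun m hm => ?_⟩
      simp only [map_add, Finset.sum_add_distrib]
      rw [ha m (le_trans (le_max_left a b) hm), hb m (le_trans (le_max_right a b) hm), add_zero]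
    · rintro c x - ⟨a, ha⟩
      refine ⟨a, fun m hm => ?_⟩
      simp only [map_smul]
      rw [← Finset.smul_sum, ha m hm, smul_zero]
  obtain ⟨m, hm⟩ := key
  have h := hm m le_rfl
  simp only [hfix _ (Subtype.prop _), Finset.sum_const, Finset.card_univ] at h
  rw [← Nat.card_eq_fintype_card, ← Nat.cast_smul_eq_nsmul k] at h
  exact (smul_eq_zero.1 h).resolve_left (hindex m)

/-- A finitely generated nonzero quotient of a representation has an irreducible quotient. -/
theorem exists_irreducible_quotient (X : Submodule k V) (hX : ∀ g, ∀ v ∈ X, π g v ∈ X)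
    (hXtop : X ≠ ⊤) (S : Set V) (hS : S.Finite)
    (hspan : ∀ Y : Submodule k V, X ≤ Y → (∀ g, ∀ v ∈ Y, π g v ∈ Y) → S ⊆ Y → Y = ⊤) :
    ∃ (Y : Submodule k V) (hY : ∀ g, Y ≤ Y.comap (π g)), X ≤ Y ∧ Y ≠ ⊤ ∧
      (π.quotient Y hY).IsIrreducible := by
  -- Maximality is sought among stable subspaces not containing S: as S is finite this passes to
  -- unions of chains, and by `hspan` it is the same as being proper.
  let P : Set (Submodule k V) := {Y | X ≤ Y ∧ (∀ g, ∀ v ∈ Y, π g v ∈ Y) ∧ ¬ S ⊆ Y}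
  have hXP : X ∈ P := ⟨le_rfl, hX, fun h => hXtop (hspan X le_rfl hX h)⟩
  obtain ⟨Y, hXY, hYmax⟩ := zorn_le_nonempty₀ P (by
    intro c hc hchain y hy
    refine ⟨sSup c, ⟨(hc hy).1.trans (le_sSup hy), ?_, ?_⟩, fun z hz => le_sSup hz⟩
    · intro g v hv
      rw [Submodule.mem_sSup_of_directed ⟨y, hy⟩ hchain.directedOn] at hv ⊢
      obtain ⟨z, hz, hvz⟩ := hv
      exact ⟨z, hz, (hc hz).2.1 g v hvz⟩
    · intro hSc
      have key : ∀ T : Set V, T.Finite → T ⊆ (sSup c : Submodule k V) → ∃ z ∈ c, T ⊆ z := by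
        intro T hT
        induction T, hT using Set.Finite.induction_on with
        | empty => exact fun _ => ⟨y, hy, Set.empty_subset _⟩
        | @insert a s _ _ ih =>
          intro hs
          obtain ⟨z, hz, hsz⟩ := ih ((Set.subset_insert _ _).trans hs)
          have ha : a ∈ (sSup c : Submodule k V) := hs (Set.mem_insert _ _)
          rw [Submodule.mem_sSup_of_directed ⟨y, hy⟩ hchain.directedOn] at ha
          obtain ⟨z', hz', haz⟩ := ha
          obtain ⟨x, hx, h1, h2⟩ := hchain.directedOn z hz z' hz'
          exact ⟨x, hx, Set.insert_subset (h2 haz) (hsz.trans h1)⟩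
      obtain ⟨z, hz, h⟩ := key S hS hSc
      exact (hc hz).2.2 h) X hXP
  have hYP := hYmax.prop
  refine ⟨Y, hYP.2.1, hXY, fun h => hYP.2.2 (by simp [h]), ?_⟩
  have hYtop : Y ≠ ⊤ := fun h => hYP.2.2 (by simp [h])
  have : Nontrivial (V ⧸ Y) := Submodule.Quotient.nontrivial_iff.2 hYtop
  refine { exists_pair_ne := ⟨⊥, ⊤, fun h => ?_⟩, eq_bot_or_eq_top := fun σ => ?_ }
  · have := congrArg Subrepresentation.toSubmodule h
    exact bot_ne_top this
  · have hst : ∀ g, ∀ v ∈ σ.toSubmodule.comap Y.mkQ, π g v ∈ σ.toSubmodule.comap Y.mkQ :=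
      fun g v hv => σ.apply_mem_toSubmodule g hv
    have hle : Y ≤ σ.toSubmodule.comap Y.mkQ := fun y hy => by
      rw [Submodule.mem_comap, Submodule.mkQ_apply, (Submodule.Quotient.mk_eq_zero Y).2 hy]
      exact zero_mem _
    by_cases hSσ : S ⊆ σ.toSubmodule.comap Y.mkQ
    · right
      have h := hspan _ (hXY.trans hle) hst hSσ
      apply Subrepresentation.toSubmodule_injective
      refine Submodule.eq_top_iff'.2 fun x => ?_
      obtain ⟨x, rfl⟩ := Submodule.mkQ_surjective Y x
      have : x ∈ σ.toSubmodule.comap Y.mkQ := by rw [h]; trivial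
      exact this
    · left
      have h := hYmax.le_of_ge ⟨hXY.trans hle, hst, hSσ⟩ hle
      apply Subrepresentation.toSubmodule_injective
      refine (Submodule.eq_bot_iff _).2 fun x hx => ?_
      obtain ⟨x, rfl⟩ := Submodule.mkQ_surjective Y x
      exact (Submodule.Quotient.mk_eq_zero Y).2 (h hx)

/-- An irreducible representation of a finitely generated commutative group over an algebraically
closed field is given by scalars. -/
theorem exists_scalar_of_irreducible_of_commGroup [IsAlgClosed k] {C : Type*} [CommGroup C]
    [Group.FG C] (σ : Representation k C V) (hσ : σ.IsIrreducible) (c : C) :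
    ∃ s : k, ∀ v, σ c v = s • v := by
  have h := (Representation.irreducible_iff_isSimpleModule_asModule σ).1 hσ
  obtain ⟨I, hI, ⟨e⟩⟩ := isSimpleModule_iff_quot_maximal.1 h
  let _ := Ideal.Quotient.field I
  -- Nullstellensatz: the simple module is a quotient field of the finitely generated algebra k[C],
  -- so it is finite over k and hence equal to k.
  have : Module.Finite k (MonoidAlgebra k C ⧸ I) := finite_of_finite_type_of_isJacobsonRing _ _
  obtain ⟨s, hs⟩ := (IsAlgClosed.algebraMap_bijective_of_isIntegral
    (k := k) (K := MonoidAlgebra k C ⧸ I)).2 (Ideal.Quotient.mk I (MonoidAlgebra.of k C c))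
  have hs' : MonoidAlgebra.of k C c - algebraMap k _ s ∈ I := by
    rw [← Ideal.Quotient.eq, ← hs]; rfl
  refine ⟨s, fun v => ?_⟩
  have key : (MonoidAlgebra.of k C c - algebraMap k _ s) • σ.asModuleEquiv.symm v = 0 := by
    apply e.injective
    rw [map_smul, map_zero]
    obtain ⟨y, hy⟩ := Ideal.Quotient.mk_surjective (e (σ.asModuleEquiv.symm v))
    rw [← hy]
    change Ideal.Quotient.mk I (_ * y) = 0
    exact Ideal.Quotient.eq_zero_iff_mem.2 (I.mul_mem_right _ hs')
  rw [sub_smul, sub_eq_zero, ← σ.asModuleEquiv_symm_map_rho, ← σ.asModuleEquiv_symm_map_smul] at key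
  exact σ.asModuleEquiv.symm.injective key

/-- A central element acts by a scalar on an irreducible representation with a proper subspace `X`,
stable under a finitely generated central subgroup `C`, such that `V/X` is finitely generated
over `C`. -/
theorem exists_scalar_of_central [IsAlgClosed k] {C : Type*} [CommGroup C] [Group.FG C]
    (f : C →* G) (hf : ∀ c g, Commute (f c) g)
    (hirr : ∀ Y : Submodule k V, (∀ g, ∀ v ∈ Y, π g v ∈ Y) → Y = ⊥ ∨ Y = ⊤)
    (X : Submodule k V) (hX : ∀ c, ∀ v ∈ X, π (f c) v ∈ X) (hXtop : X ≠ ⊤) (S : Set V)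
    (hS : S.Finite)
    (hspan : ∀ Y : Submodule k V, X ≤ Y → (∀ c, ∀ v ∈ Y, π (f c) v ∈ Y) → S ⊆ Y → Y = ⊤) (c : C) :
    ∃ s : k, ∀ v, π (f c) v = s • v := by
  obtain ⟨Y, hY, -, hYtop, hYirr⟩ :=
    exists_irreducible_quotient (π := π.comp f) X hX hXtop S hS hspan
  obtain ⟨s, hs⟩ := exists_scalar_of_irreducible_of_commGroup _ hYirr c
  refine ⟨s, fun v => ?_⟩
  -- The image of T lies in the proper subspace Y, and it is a subrepresentation because `f c` is
  -- central; by irreducibility it is zero.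
  let T : V →ₗ[k] V := π (f c) - s • LinearMap.id
  have hT : LinearMap.range T ≤ Y := by
    rintro _ ⟨v, rfl⟩
    have := hs (Y.mkQ v)
    rw [← map_smul] at this
    exact (Submodule.Quotient.eq Y).1 this
  have hst : ∀ g, ∀ v ∈ LinearMap.range T, π g v ∈ LinearMap.range T := by
    rintro g _ ⟨v, rfl⟩
    refine ⟨π g v, ?_⟩
    simp only [T, LinearMap.sub_apply, LinearMap.smul_apply, LinearMap.id_apply, map_sub, map_smul]
    rw [← Module.End.mul_apply, ← Module.End.mul_apply, ← map_mul, ← map_mul, (hf c g).eq]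
  rcases hirr _ hst with h | h
  · have := LinearMap.congr_fun (LinearMap.range_eq_bot.1 h) v
    exact sub_eq_zero.1 this
  · exact absurd (top_le_iff.1 (h ▸ hT)) hYtop

end Abstract

/-! ### Integral Gaussian elimination and the Cartan decomposition. -/

section Elimination

variable {F : Type*} [Field F] {n : ℕ}

variable (F) in
/-- The standard Levi subgroup of block matrices attached to `d`. -/
def blockGroup (d : Fin n → ℤ) : Subgroup (GL (Fin n) F) := (⟨1, d⟩ : Cocharacter n F).levi

theorem mem_blockGroup {d : Fin n → ℤ} {g : GL (Fin n) F} :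
    g ∈ blockGroup F d ↔ ∀ i j, d i ≠ d j → (g : Matrix (Fin n) (Fin n) F) i j = 0 := by
  rw [blockGroup, Cocharacter.mem_levi_iff]
  simp [Cocharacter.coords]

/-- The elementary matrix adding multiples of column `i` to the other columns. -/
def colOp (i : Fin n) (c : Fin n → F) (hc : c i = 0) : GL (Fin n) F where
  val := 1 + vecMulVec (Pi.single i 1) c
  inv := 1 - vecMulVec (Pi.single i 1) c
  val_inv := by
    have : vecMulVec (Pi.single i 1) c * vecMulVec (Pi.single i 1) c = 0 := by
      rw [vecMulVec_mul_vecMulVec]; simp [hc]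
    noncomm_ring; simp [this]
  inv_val := by
    have : vecMulVec (Pi.single i 1) c * vecMulVec (Pi.single i 1) c = 0 := by
      rw [vecMulVec_mul_vecMulVec]; simp [hc]
    noncomm_ring; simp [this]

/-- The elementary matrix adding multiples of row `i` to the other rows. -/
def rowOp (i : Fin n) (c : Fin n → F) (hc : c i = 0) : GL (Fin n) F where
  val := 1 + vecMulVec c (Pi.single i 1)
  inv := 1 - vecMulVec c (Pi.single i 1)
  val_inv := by
    have : vecMulVec c (Pi.single i 1) * vecMulVec c (Pi.single i 1) = 0 := by
      rw [vecMulVec_mul_vecMulVec]; simp [hc]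
    noncomm_ring; simp [this]
  inv_val := by
    have : vecMulVec c (Pi.single i 1) * vecMulVec c (Pi.single i 1) = 0 := by
      rw [vecMulVec_mul_vecMulVec]; simp [hc]
    noncomm_ring; simp [this]

theorem mul_colOp_apply (i : Fin n) (c : Fin n → F) (hc : c i = 0) (g : GL (Fin n) F)
    (a b : Fin n) :
    ((g * colOp i c hc : GL (Fin n) F) : Matrix (Fin n) (Fin n) F) a b = g a b + g a i * c b := by
  simp [colOp, mul_add, Matrix.mul_apply, vecMulVec_apply, Pi.single_apply, Matrix.one_apply,
    Finset.sum_add_distrib]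

theorem rowOp_mul_apply (i : Fin n) (c : Fin n → F) (hc : c i = 0) (g : GL (Fin n) F)
    (a b : Fin n) :
    ((rowOp i c hc * g : GL (Fin n) F) : Matrix (Fin n) (Fin n) F) a b = g a b + c a * g i b := by
  simp [rowOp, add_mul, Matrix.mul_apply, vecMulVec_apply, Pi.single_apply, Matrix.one_apply,
    Finset.sum_add_distrib]

theorem colOp_mem_blockGroup {d : Fin n → ℤ} {i : Fin n} {c : Fin n → F} {hc : c i = 0}
    (h : ∀ j, d i ≠ d j → c j = 0) : colOp i c hc ∈ blockGroup F d := by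
  rw [mem_blockGroup]
  intro a b hab
  have : a ≠ b := fun e => hab (by rw [e])
  by_cases ha : a = i
  · subst ha; simp [colOp, vecMulVec_apply, h b hab, this]
  · simp [colOp, vecMulVec_apply, ha, this]

theorem rowOp_mem_blockGroup {d : Fin n → ℤ} {i : Fin n} {c : Fin n → F} {hc : c i = 0}
    (h : ∀ j, d i ≠ d j → c j = 0) : rowOp i c hc ∈ blockGroup F d := by
  rw [mem_blockGroup]
  intro a b hab
  have : a ≠ b := fun e => hab (by rw [e])
  by_cases hb : b = i
  · subst hb; simp [rowOp, vecMulVec_apply, h a hab.symm, this]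
  · simp [rowOp, vecMulVec_apply, hb, this]

/-- The permutation matrix of a transposition. -/
def swapGL (F : Type*) [Field F] (i j : Fin n) : GL (Fin n) F where
  val := Matrix.of fun a b => if a = Equiv.swap i j b then 1 else 0
  inv := Matrix.of fun a b => if a = Equiv.swap i j b then 1 else 0
  val_inv := by
    ext a b
    simp [Matrix.mul_apply, Matrix.one_apply]
  inv_val := by
    ext a b
    simp [Matrix.mul_apply, Matrix.one_apply]

theorem mul_swapGL_apply (i j : Fin n) (g : GL (Fin n) F) (a b : Fin n) :
    ((g * swapGL F i j : GL (Fin n) F) : Matrix (Fin n) (Fin n) F) a b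
      = g a (Equiv.swap i j b) := by
  simp [swapGL, Matrix.mul_apply]

theorem swapGL_mul_apply (i j : Fin n) (g : GL (Fin n) F) (a b : Fin n) :
    ((swapGL F i j * g : GL (Fin n) F) : Matrix (Fin n) (Fin n) F) a b
      = g (Equiv.swap i j a) b := by
  have : ∀ c, (a = Equiv.swap i j c) ↔ (c = Equiv.swap i j a) := fun c => by
    constructor <;> rintro rfl <;> simp
  simp [swapGL, Matrix.mul_apply, this]

theorem swap_block {d : Fin n → ℤ} {i j : Fin n} (h : d i = d j) (a : Fin n) :
    d (Equiv.swap i j a) = d a := by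
  by_cases h1 : a = i
  · subst h1; rw [Equiv.swap_apply_left, h]
  by_cases h2 : a = j
  · subst h2; rw [Equiv.swap_apply_right, h]
  rw [Equiv.swap_apply_of_ne_of_ne h1 h2]

theorem swapGL_mem_blockGroup {d : Fin n → ℤ} {i j : Fin n} (h : d i = d j) :
    swapGL F i j ∈ blockGroup F d := by
  rw [mem_blockGroup]
  intro a b hab
  have : a ≠ Equiv.swap i j b := fun e => hab (by rw [e, swap_block h])
  simp [swapGL, this]

theorem diagGL_apply (a : Fin n → ℤ) (t : Fˣ) (i j : Fin n) :
    (diagGL a t : Matrix (Fin n) (Fin n) F) i j = if i = j then ((t ^ a i : Fˣ) : F) else 0 := by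
  simp [diagGL, Matrix.diagonal_apply]

theorem diagGL_inv_apply (a : Fin n → ℤ) (t : Fˣ) (i j : Fin n) :
    (((diagGL a t)⁻¹ : GL (Fin n) F) : Matrix (Fin n) (Fin n) F) i j
      = if i = j then ((t ^ (-a i) : Fˣ) : F) else 0 := by
  change Matrix.diagonal (fun i => ((t ^ (-a i) : Fˣ) : F)) i j = _
  rw [Matrix.diagonal_apply]

theorem diagGL_mem_blockGroup (d a : Fin n → ℤ) (t : Fˣ) : diagGL a t ∈ blockGroup F d := by
  rw [mem_blockGroup]
  intro i j hij
  rw [diagGL_apply, if_neg fun e => hij (by rw [e])]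

variable [ValuativeRel F] [TopologicalSpace F] [IsNonarchimedeanLocalField F]

theorem ite_mem_fracIdeal (P : Prop) [Decidable P] : (if P then (1 : F) else 0) ∈ fracIdeal F 0 := by
  split_ifs
  · exact one_mem_fracIdeal
  · exact zero_mem _

theorem colOp_mem_congSubgroup {i : Fin n} {c : Fin n → F} {hc : c i = 0}
    (h : ∀ j, c j ∈ fracIdeal F 0) : colOp i c hc ∈ congSubgroup F n 0 := by
  have key : ∀ a b, (vecMulVec (Pi.single i 1) c : Matrix (Fin n) (Fin n) F) a b ∈ fracIdeal F 0 := by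
    intro a b
    rw [vecMulVec_apply, Pi.single_apply]
    exact mul_mem_fracIdeal' (ite_mem_fracIdeal _) (h b) (by omega)
  rw [mem_congSubgroup_zero]
  exact ⟨fun a b => add_mem (matOne_mem_fracIdeal a b) (key a b),
    fun a b => sub_mem (matOne_mem_fracIdeal a b) (key a b)⟩

theorem rowOp_mem_congSubgroup {i : Fin n} {c : Fin n → F} {hc : c i = 0}
    (h : ∀ j, c j ∈ fracIdeal F 0) : rowOp i c hc ∈ congSubgroup F n 0 := by
  have key : ∀ a b, (vecMulVec c (Pi.single i 1) : Matrix (Fin n) (Fin n) F) a b ∈ fracIdeal F 0 := by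
    intro a b
    rw [vecMulVec_apply, Pi.single_apply]
    exact mul_mem_fracIdeal' (h a) (ite_mem_fracIdeal _) (by omega)
  rw [mem_congSubgroup_zero]
  exact ⟨fun a b => add_mem (matOne_mem_fracIdeal a b) (key a b),
    fun a b => sub_mem (matOne_mem_fracIdeal a b) (key a b)⟩

theorem swapGL_mem_congSubgroup (i j : Fin n) : swapGL F i j ∈ congSubgroup F n 0 := by
  rw [mem_congSubgroup_zero]
  exact ⟨fun a b => ite_mem_fracIdeal _, fun a b => ite_mem_fracIdeal _⟩

variable (F) in
/-- The maximal compact subgroup of integral matrices in the standard Levi subgroup. -/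
noncomputable def intBlock (d : Fin n → ℤ) : Subgroup (GL (Fin n) F) :=
  congSubgroup F n 0 ⊓ blockGroup F d

theorem swapGL_mem_intBlock {d : Fin n → ℤ} {i j : Fin n} (h : d i = d j) :
    swapGL F i j ∈ intBlock F d :=
  ⟨swapGL_mem_congSubgroup i j, swapGL_mem_blockGroup h⟩

/-- Column elimination with integral operations, for the rows in `S`. -/
theorem exists_mul_eq_zero (d : Fin n → ℤ) (S : Finset (Fin n)) {g : GL (Fin n) F}
    (hg : g ∈ blockGroup F d) : ∃ k ∈ intBlock F d, ∀ i ∈ S, ∀ j ∉ S,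
      ((g * k : GL (Fin n) F) : Matrix (Fin n) (Fin n) F) i j = 0 := by
  classical
  induction S using Finset.induction_on with
  | empty => exact ⟨1, one_mem _, by simp⟩
  | insert i S hi ih =>
    obtain ⟨k, hk, hz⟩ := ih
    -- The pivot is an entry of largest absolute value in row i, among columns outside S in the
    -- block of i. All quotients by it are integral.
    obtain ⟨j₀, hj₀, hmax⟩ := Finset.exists_max_image
      (Finset.univ.filter fun j => j ∉ S ∧ d i = d j)
      (fun j => ordVal F (((g * k : GL (Fin n) F) : Matrix (Fin n) (Fin n) F) i j))
      ⟨i, by simp [hi]⟩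
    simp only [Finset.mem_filter, Finset.mem_univ, true_and] at hj₀ hmax
    set w := swapGL F i j₀ with hw
    have hwm : w ∈ intBlock F d := swapGL_mem_intBlock hj₀.2
    set h := g * k * w with hh
    have hhb : h ∈ blockGroup F d := mul_mem (mul_mem hg hk.2) hwm.2
    have happ : ∀ a b, (h : Matrix (Fin n) (Fin n) F) a b
        = ((g * k : GL (Fin n) F) : Matrix (Fin n) (Fin n) F) a (Equiv.swap i j₀ b) :=
      fun a b => mul_swapGL_apply i j₀ (g * k) a b
    have hsw : ∀ j, j ∉ S → Equiv.swap i j₀ j ∉ S := by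
      intro j hj
      rw [Equiv.swap_apply_def]
      split_ifs
      · exact hj₀.1
      · exact hi
      · exact hj
    have hS : ∀ a ∈ S, ∀ b ∉ S, (h : Matrix (Fin n) (Fin n) F) a b = 0 := fun a ha b hb => by
      rw [happ]; exact hz a ha _ (hsw b hb)
    have hpiv : ∀ b ∉ S, ordVal F ((h : Matrix (Fin n) (Fin n) F) i b)
        ≤ ordVal F ((h : Matrix (Fin n) (Fin n) F) i i) := by
      intro b hb
      by_cases hdb : d i = d b
      · rw [happ, happ, Equiv.swap_apply_left]
        exact hmax _ ⟨hsw b hb, by rw [swap_block hj₀.2]; exact hdb⟩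
      · rw [mem_blockGroup.1 hhb i b hdb, map_zero]; exact zero_le
    let c : Fin n → F := fun b => if b ∈ insert i S then 0 else
      -((h : Matrix (Fin n) (Fin n) F) i b / (h : Matrix (Fin n) (Fin n) F) i i)
    have hci : c i = 0 := by simp [c]
    have hcO : ∀ b, c b ∈ fracIdeal F 0 := by
      intro b
      simp only [c]
      split_ifs with hb
      · exact zero_mem _
      · exact neg_mem (div_mem_fracIdeal (hpiv b fun h => hb (Finset.mem_insert_of_mem h)))
    have hcd : ∀ b, d i ≠ d b → c b = 0 := by
      intro b hb
      simp [c, mem_blockGroup.1 hhb i b hb]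
    refine ⟨k * w * colOp i c hci, mul_mem (mul_mem hk hwm)
      ⟨colOp_mem_congSubgroup hcO, colOp_mem_blockGroup hcd⟩, fun a ha b hb => ?_⟩
    rw [← mul_assoc, ← mul_assoc, mul_colOp_apply]
    have hbS : b ∉ S := fun h => hb (Finset.mem_insert_of_mem h)
    rcases Finset.mem_insert.1 ha with rfl | ha
    · change h a b + h a a * c b = 0
      simp only [c, hb, if_false]
      -- A zero pivot, being of largest absolute value, means that the entries to be cleared already
      -- vanish.
      by_cases h0 : (h : Matrix (Fin n) (Fin n) F) a a = 0
      · have h1 := hpiv b hbS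
        rw [h0, map_zero, le_zero_iff, map_eq_zero] at h1
        rw [h1, h0]; simp
      · field_simp; ring
    · change h a b + h a i * c b = 0
      rw [hS a ha b hbS, hS a ha i hi]; simp

/-- Row and column elimination with integral operations. -/
theorem exists_mul_mul_eq_zero (d : Fin n → ℤ) (S : Finset (Fin n)) {g : GL (Fin n) F}
    (hg : g ∈ blockGroup F d) : ∃ k₁ ∈ intBlock F d, ∃ k₂ ∈ intBlock F d, ∀ i ∈ S, ∀ j, j ≠ i →
      ((k₁ * g * k₂ : GL (Fin n) F) : Matrix (Fin n) (Fin n) F) i j = 0 ∧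
      ((k₁ * g * k₂ : GL (Fin n) F) : Matrix (Fin n) (Fin n) F) j i = 0 := by
  classical
  induction S using Finset.induction_on with
  | empty => exact ⟨1, one_mem _, 1, one_mem _, by simp⟩
  | insert i S hi ih =>
    obtain ⟨k₁, hk₁, k₂, hk₂, hz⟩ := ih
    set g' := k₁ * g * k₂ with hg'
    -- Here the pivot is maximal over all remaining rows and columns of the block, so that both row
    -- and column quotients are integral.
    obtain ⟨⟨i₀, j₀⟩, hij, hmax⟩ := Finset.exists_max_image
      ((Finset.univ.filter fun j => j ∉ S ∧ d i = d j) ×ˢ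
        (Finset.univ.filter fun j => j ∉ S ∧ d i = d j))
      (fun x => ordVal F ((g' : Matrix (Fin n) (Fin n) F) x.1 x.2))
      ⟨(i, i), by simp [hi]⟩
    simp only [Finset.mem_product, Finset.mem_filter, Finset.mem_univ, true_and, Prod.forall]
      at hij hmax
    obtain ⟨hi₀, hj₀⟩ := hij
    set w₁ := swapGL F i i₀
    set w₂ := swapGL F i j₀
    have hw₁ : w₁ ∈ intBlock F d := swapGL_mem_intBlock hi₀.2
    have hw₂ : w₂ ∈ intBlock F d := swapGL_mem_intBlock hj₀.2
    set h := w₁ * g' * w₂ with hh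
    have hhb : h ∈ blockGroup F d :=
      mul_mem (mul_mem hw₁.2 (mul_mem (mul_mem hk₁.2 hg) hk₂.2)) hw₂.2
    have happ : ∀ a b, (h : Matrix (Fin n) (Fin n) F) a b
        = (g' : Matrix (Fin n) (Fin n) F) (Equiv.swap i i₀ a) (Equiv.swap i j₀ b) := by
      intro a b
      rw [hh, mul_swapGL_apply, swapGL_mul_apply]
    have hsw : ∀ j₀, j₀ ∉ S → ∀ j, j ∉ S → Equiv.swap i j₀ j ∉ S := by
      intro j₀ hj₀ j hj
      rw [Equiv.swap_apply_def]
      split_ifs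
      · exact hj₀
      · exact hi
      · exact hj
    have hsw' : ∀ j₀, j₀ ∉ S → ∀ j ∈ S, Equiv.swap i j₀ j = j := by
      intro j₀ hj₀ j hj
      exact Equiv.swap_apply_of_ne_of_ne (fun e => hi (e ▸ hj)) (fun e => hj₀ (e ▸ hj))
    have hS : ∀ a ∈ S, ∀ b, b ≠ a → (h : Matrix (Fin n) (Fin n) F) a b = 0 ∧
        (h : Matrix (Fin n) (Fin n) F) b a = 0 := by
      intro a ha b hb
      rw [happ, happ, hsw' i₀ hi₀.1 a ha, hsw' j₀ hj₀.1 a ha]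
      refine ⟨(hz a ha _ fun e => hb ?_).1, (hz a ha _ fun e => hb ?_).2⟩
      · rw [← hsw' j₀ hj₀.1 a ha] at e; exact (Equiv.swap i j₀).injective e
      · rw [← hsw' i₀ hi₀.1 a ha] at e; exact (Equiv.swap i i₀).injective e
    have hpiv : ∀ a ∉ S, ∀ b ∉ S, d i = d a → d i = d b →
        ordVal F ((h : Matrix (Fin n) (Fin n) F) a b)
        ≤ ordVal F ((h : Matrix (Fin n) (Fin n) F) i i) := by
      intro a ha b hb hda hdb
      rw [happ, happ, Equiv.swap_apply_left, Equiv.swap_apply_left]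
      exact hmax _ _ ⟨⟨hsw _ hi₀.1 a ha, by rw [swap_block hi₀.2]; exact hda⟩,
        ⟨hsw _ hj₀.1 b hb, by rw [swap_block hj₀.2]; exact hdb⟩⟩
    let c : Fin n → F := fun b => if b ∈ insert i S then 0 else
      -((h : Matrix (Fin n) (Fin n) F) i b / (h : Matrix (Fin n) (Fin n) F) i i)
    let r : Fin n → F := fun b => if b ∈ insert i S then 0 else
      -((h : Matrix (Fin n) (Fin n) F) b i / (h : Matrix (Fin n) (Fin n) F) i i)
    have hci : c i = 0 := by simp [c]
    have hri : r i = 0 := by simp [r]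
    have hcd : ∀ b, d i ≠ d b → c b = 0 := by
      intro b hb
      simp [c, mem_blockGroup.1 hhb i b hb]
    have hrd : ∀ b, d i ≠ d b → r b = 0 := by
      intro b hb
      simp [r, mem_blockGroup.1 hhb b i (Ne.symm hb)]
    have hcO : ∀ b, c b ∈ fracIdeal F 0 := by
      intro b
      by_cases hb : d i = d b
      · simp only [c]
        split_ifs with hb'
        · exact zero_mem _
        · exact neg_mem (div_mem_fracIdeal
            (hpiv i hi b (fun h => hb' (Finset.mem_insert_of_mem h)) rfl hb))
      · rw [hcd b hb]; exact zero_mem _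
    have hrO : ∀ b, r b ∈ fracIdeal F 0 := by
      intro b
      by_cases hb : d i = d b
      · simp only [r]
        split_ifs with hb'
        · exact zero_mem _
        · exact neg_mem (div_mem_fracIdeal
            (hpiv b (fun h => hb' (Finset.mem_insert_of_mem h)) i hi hb rfl))
      · rw [hrd b hb]; exact zero_mem _
    have hcS : ∀ b ∈ S, c b = 0 := fun b hb => by simp [c, hb]
    have hrS : ∀ b ∈ S, r b = 0 := fun b hb => by simp [r, hb]
    have hc0 : ∀ b, b ≠ i → (h : Matrix (Fin n) (Fin n) F) i b
        + (h : Matrix (Fin n) (Fin n) F) i i * c b = 0 := by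
      intro b hb
      by_cases hbS : b ∈ S
      · rw [(hS b hbS i hb.symm).2, hcS b hbS]; simp
      by_cases hdb : d i = d b
      · simp only [c, Finset.mem_insert, hb, hbS, or_self, if_false]
        by_cases h0 : (h : Matrix (Fin n) (Fin n) F) i i = 0
        · have h1 := hpiv i hi b hbS rfl hdb
          rw [h0, map_zero, le_zero_iff, map_eq_zero] at h1
          rw [h1, h0]; simp
        · field_simp; ring
      · rw [mem_blockGroup.1 hhb i b hdb, hcd b hdb]; simp
    have hr0 : ∀ b, b ≠ i → (h : Matrix (Fin n) (Fin n) F) b i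
        + r b * (h : Matrix (Fin n) (Fin n) F) i i = 0 := by
      intro b hb
      by_cases hbS : b ∈ S
      · rw [(hS b hbS i hb.symm).1, hrS b hbS]; simp
      by_cases hdb : d i = d b
      · simp only [r, Finset.mem_insert, hb, hbS, or_self, if_false]
        by_cases h0 : (h : Matrix (Fin n) (Fin n) F) i i = 0
        · have h1 := hpiv b hbS i hi hdb rfl
          rw [h0, map_zero, le_zero_iff, map_eq_zero] at h1
          rw [h1, h0]; simp
        · field_simp; ring
      · rw [mem_blockGroup.1 hhb b i (Ne.symm hdb), hrd b hdb]; simp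
    refine ⟨rowOp i r hri * w₁ * k₁, mul_mem (mul_mem
      ⟨rowOp_mem_congSubgroup hrO, rowOp_mem_blockGroup hrd⟩ hw₁) hk₁,
      k₂ * w₂ * colOp i c hci, mul_mem (mul_mem hk₂ hw₂)
      ⟨colOp_mem_congSubgroup hcO, colOp_mem_blockGroup hcd⟩, fun a ha b hb => ?_⟩
    have hprod : rowOp i r hri * w₁ * k₁ * g * (k₂ * w₂ * colOp i c hci)
        = rowOp i r hri * h * colOp i c hci := by
      rw [hh, hg']; group
    rw [hprod]
    simp only [mul_colOp_apply, rowOp_mul_apply]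
    rcases Finset.mem_insert.1 ha with rfl | ha
    · rw [hri, hci]
      refine ⟨?_, ?_⟩
      · simpa using hc0 b hb
      · simpa using hr0 b hb
    · have hia : i ≠ a := fun e => hi (e ▸ ha)
      rw [hrS a ha, hcS a ha, (hS a ha b hb).1, (hS a ha b hb).2, (hS a ha i hia).1,
        (hS a ha i hia).2]
      simp

/-- The Cartan decomposition. -/
theorem exists_cartan {t : Fˣ} (ht : ordVal F (t : F) = WithZero.exp (-1)) (d : Fin n → ℤ)
    {g : GL (Fin n) F} (hg : g ∈ blockGroup F d) :
    ∃ k₁ ∈ intBlock F d, ∃ k₂ ∈ intBlock F d, ∃ a : Fin n → ℤ, g = k₁ * diagGL a t * k₂ := by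
  obtain ⟨k₁, hk₁, k₂, hk₂, hz⟩ := exists_mul_mul_eq_zero d Finset.univ hg
  set D := k₁ * g * k₂ with hD
  have hoff : ∀ i j, i ≠ j → (D : Matrix (Fin n) (Fin n) F) i j = 0 := fun i j hij =>
    (hz i (Finset.mem_univ i) j hij.symm).1
  have hinv : ∀ i j, ((D⁻¹ : GL (Fin n) F) : Matrix (Fin n) (Fin n) F) i j
      * (D : Matrix (Fin n) (Fin n) F) j j = (1 : Matrix (Fin n) (Fin n) F) i j := by
    intro i j
    rw [← Units.inv_mul D, Matrix.mul_apply, Finset.sum_eq_single j]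
    · intro b _ hb; rw [hoff b j hb, mul_zero]
    · simp
  have hne : ∀ j, (D : Matrix (Fin n) (Fin n) F) j j ≠ 0 := by
    intro j h0
    have := hinv j j
    rw [h0] at this; simp at this
  choose a u hau hu hu' using fun j => exists_eq_zpow_mul ht (Units.mk0 _ (hne j))
  have hDa : ∀ j, (D : Matrix (Fin n) (Fin n) F) j j = ((t ^ a j : Fˣ) : F) * u j := fun j => by
    rw [← Units.val_mul, ← hau]; rfl
  have hT : ∀ j, ((t ^ (-a j) : Fˣ) : F) * ((t ^ a j : Fˣ) : F) = 1 := fun j => by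
    rw [← Units.val_mul, ← _root_.zpow_add]; simp
  have hval : ∀ i j, (((diagGL a t)⁻¹ * D : GL (Fin n) F) : Matrix (Fin n) (Fin n) F) i j
      = if i = j then (u i : F) else 0 := by
    intro i j
    rw [Units.val_mul, Matrix.mul_apply, Finset.sum_eq_single i]
    · rw [diagGL_inv_apply, if_pos rfl]
      split_ifs with h
      · subst h; rw [hDa, ← mul_assoc, hT, one_mul]
      · rw [hoff i j h, mul_zero]
    · intro b _ hb; rw [diagGL_inv_apply, if_neg hb.symm, zero_mul]
    · simp
  have hval' : ∀ i j, ((((diagGL a t)⁻¹ * D)⁻¹ : GL (Fin n) F) : Matrix (Fin n) (Fin n) F) i j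
      = if i = j then ((u i)⁻¹ : F) else 0 := by
    intro i j
    have h1 : ((((diagGL a t)⁻¹ * D)⁻¹ : GL (Fin n) F) : Matrix (Fin n) (Fin n) F) i j * u j
        = (1 : Matrix (Fin n) (Fin n) F) i j := by
      rw [← Units.inv_mul ((diagGL a t)⁻¹ * D), Matrix.mul_apply, Finset.sum_eq_single j]
      · rw [hval, if_pos rfl]
      · intro b _ hb; rw [hval, if_neg hb, mul_zero]
      · simp
    rw [eq_div_iff_mul_eq (Units.ne_zero (u j)) |>.2 h1, Matrix.one_apply]
    split_ifs with h
    · subst h; simp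
    · simp
  -- The unit parts of the diagonal entries form an integral diagonal matrix, absorbed into the
  -- right-hand factor.
  refine ⟨k₁⁻¹, inv_mem hk₁, (diagGL a t)⁻¹ * D * k₂⁻¹, mul_mem ⟨mem_congSubgroup_zero.2
    ⟨fun i j => ?_, fun i j => ?_⟩, mul_mem ((blockGroup F d).inv_mem (diagGL_mem_blockGroup d a t))
      (mul_mem (mul_mem hk₁.2 hg) hk₂.2)⟩ (inv_mem hk₂), a, ?_⟩
  · rw [hval]; split_ifs
    · exact hu i
    · exact zero_mem _
  · rw [hval']; split_ifs
    · simpa using hu' i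
    · exact zero_mem _
  · rw [hD]; group

end Elimination

/-! ### The Levi decomposition. -/

section Levi

variable {F : Type*} [Field F] {n : ℕ}

/-- The Levi decomposition of a parabolic subgroup. -/
theorem exists_levi_unipotent (l : Cocharacter n F) {g : GL (Fin n) F} (hg : g ∈ l.parabolic) :
    ∃ m ∈ l.levi, m⁻¹ * g ∈ l.unipotentRadical ∧
      ∀ i j, l.coords m i j = if l.d i = l.d j then l.coords g i j else 0 := by
  -- Taking the block-diagonal part is multiplicative on block triangular matrices, so the
  -- block-diagonal parts of g and g⁻¹ are inverse to each other.
  let D : Matrix (Fin n) (Fin n) F → Matrix (Fin n) (Fin n) F :=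
    fun A => Matrix.of fun i j => if l.d i = l.d j then A i j else 0
  have hD : ∀ A B : Matrix (Fin n) (Fin n) F, A.BlockTriangular l.d → B.BlockTriangular l.d →
      D (A * B) = D A * D B := by
    intro A B hA hB
    ext i j
    simp only [D, Matrix.of_apply, Matrix.mul_apply]
    split_ifs with hij
    · refine Finset.sum_congr rfl fun b _ => ?_
      rcases lt_trichotomy (l.d i) (l.d b) with h | h | h
      · rw [hB (i := b) (j := j) (hij ▸ h), if_neg h.ne]; simp
      · rw [if_pos h, if_pos (h.symm.trans hij)]
      · rw [hA h, if_neg h.ne']; simp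
    · refine (Finset.sum_eq_zero fun b _ => ?_).symm
      by_cases h : l.d i = l.d b
      · rw [if_neg (c := l.d b = l.d j) fun e => hij (h.trans e), mul_zero]
      · rw [if_neg h, zero_mul]
  have hD1 : D 1 = 1 := by
    ext i j
    by_cases h : i = j
    · subst h; simp [D]
    · simp [D, h]
  have hgi : (l.coords g⁻¹).BlockTriangular l.d := l.blockTriangular_coords_inv hg
  let m' : GL (Fin n) F := ⟨D (l.coords g), D (l.coords g⁻¹), by
    rw [← hD _ _ hg hgi, ← l.coords_mul, mul_inv_cancel, l.coords_one, hD1], by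
    rw [← hD _ _ hgi hg, ← l.coords_mul, inv_mul_cancel, l.coords_one, hD1]⟩
  have hm : l.coords (l.x * m' * l.x⁻¹) = D (l.coords g) := by
    rw [Cocharacter.coords]
    have : l.x⁻¹ * (l.x * m' * l.x⁻¹) * l.x = m' := by group
    rw [this]
  have hmi : l.coords (l.x * m' * l.x⁻¹)⁻¹ = D (l.coords g⁻¹) := by
    rw [Cocharacter.coords]
    have : l.x⁻¹ * (l.x * m' * l.x⁻¹)⁻¹ * l.x = m'⁻¹ := by group
    rw [this]; rfl
  have hDD : ∀ A, D (D A) = D A := by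
    intro A; ext i j; simp only [D, Matrix.of_apply]; split_ifs <;> rfl
  have hlevi : l.x * m' * l.x⁻¹ ∈ l.levi := by
    rw [Cocharacter.mem_levi_iff]
    intro i j hij
    rw [hm]; simp [D, hij]
  have hlevi' := l.levi.inv_mem hlevi
  refine ⟨l.x * m' * l.x⁻¹, hlevi, ⟨mul_mem (S := Subgroup (GL (Fin n) F)) hlevi'.1 hg, fun i j hij => ?_⟩,
    fun i j => by rw [hm]; rfl⟩
  have : l.coords ((l.x * m' * l.x⁻¹)⁻¹ * g) i j
      = D (l.coords ((l.x * m' * l.x⁻¹)⁻¹ * g)) i j := by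
    simp [D, hij]
  rw [this, l.coords_mul, hD _ _ hlevi'.1 hg, hmi, hDD, ← hD _ _ hgi hg, ← l.coords_mul,
    inv_mul_cancel, l.coords_one, hD1]

end Levi

/-! ### Levi subgroups: parabolic subgroups, centre, congruence filtration. -/

section LeviGroup

variable {F : Type*} [Field F] {n : ℕ}

/-- Conjugation of a Levi subgroup to the standard Levi subgroup. -/
def toStd (l : Cocharacter n F) : l.levi →* GL (Fin n) F :=
  (MulAut.conj l.x⁻¹).toMonoidHom.comp l.levi.subtype

theorem toStd_apply (l : Cocharacter n F) (g : l.levi) : toStd l g = l.x⁻¹ * g * l.x := by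
  simp [toStd]

theorem coords_eq (l : Cocharacter n F) (g : l.levi) :
    l.coords g = (toStd l g : Matrix (Fin n) (Fin n) F) := by
  rw [toStd_apply, Cocharacter.coords]

theorem coords_conj (l : Cocharacter n F) (g : GL (Fin n) F) :
    l.coords (l.x * g * l.x⁻¹) = g := by
  rw [Cocharacter.coords]
  have : l.x⁻¹ * (l.x * g * l.x⁻¹) * l.x = g := by group
  rw [this]

theorem toStd_mem (l : Cocharacter n F) (g : l.levi) : toStd l g ∈ blockGroup F l.d := by
  rw [mem_blockGroup]
  intro i j hij
  rw [← coords_eq]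
  exact (l.mem_levi_iff g).1 g.2 i j hij

/-- Conjugation of the standard Levi subgroup to a Levi subgroup. -/
def ofStd (l : Cocharacter n F) : blockGroup F l.d →* l.levi where
  toFun g := ⟨l.x * g * l.x⁻¹, by
    rw [Cocharacter.mem_levi_iff, coords_conj]; exact mem_blockGroup.1 g.2⟩
  map_one' := by ext1; simp
  map_mul' a b := by
    apply Subtype.ext
    simp only [Subgroup.coe_mul]
    group

theorem coe_ofStd (l : Cocharacter n F) (g : blockGroup F l.d) :
    (ofStd l g : GL (Fin n) F) = l.x * g * l.x⁻¹ := rfl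

theorem toStd_ofStd (l : Cocharacter n F) (g : blockGroup F l.d) : toStd l (ofStd l g) = g := by
  rw [toStd_apply, coe_ofStd]; group

theorem ofStd_toStd (l : Cocharacter n F) (g : l.levi) : ofStd l ⟨toStd l g, toStd_mem l g⟩ = g := by
  apply Subtype.ext
  rw [coe_ofStd]
  simp only [toStd_apply]
  group

theorem toStd_injective (l : Cocharacter n F) : Function.Injective (toStd l) := by
  intro a b h
  rw [← ofStd_toStd l a, ← ofStd_toStd l b]
  congr 1
  exact Subtype.ext h

theorem conj_mem_unipotentRadical (l : Cocharacter n F) {m u : GL (Fin n) F} (hm : m ∈ l.levi)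
    (hu : u ∈ l.unipotentRadical) : m * u * m⁻¹ ∈ l.unipotentRadical := by
  have hmi := l.levi.inv_mem hm
  refine ⟨l.parabolic.mul_mem (l.parabolic.mul_mem hm.1 hu.1) hmi.1, fun i j hij => ?_⟩
  have h1 := (l.mem_levi_iff m).1 hm
  have h2 := (l.mem_levi_iff m⁻¹).1 hmi
  have : l.coords (m * u * m⁻¹) i j = 
      (l.coords m * (1 : Matrix (Fin n) (Fin n) F) * l.coords m⁻¹) i j := by
    rw [l.coords_mul, l.coords_mul, Matrix.mul_apply, Matrix.mul_apply]
    refine Finset.sum_congr rfl fun b _ => ?_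
    by_cases hb : l.d b = l.d j
    · congr 1
      rw [Matrix.mul_apply, Matrix.mul_apply]
      refine Finset.sum_congr rfl fun a _ => ?_
      by_cases ha : l.d i = l.d a
      · rw [hu.2 a b (by rw [← ha, hb, hij])]
      · rw [h1 i a ha]; simp
    · rw [h2 b j hb]; simp
  rw [this, mul_one, ← l.coords_mul, mul_inv_cancel, l.coords_one]

/-- The cocharacter with the same eigenvectors as `l` and weights the indicator of `I`. -/
def indCochar (l : Cocharacter n F) (I : Finset (Fin n)) : Cocharacter n F :=
  ⟨l.x, fun i => if i ∈ I then 1 else 0⟩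

theorem indCochar_isIn (l : Cocharacter n F) (I : Finset (Fin n)) :
    (indCochar l I).IsIn l.levi := fun t =>
  (ofStd l ⟨diagGL (indCochar l I).d t, diagGL_mem_blockGroup _ _ _⟩).2

/-- The transvection 1 + E_ij, taken in the basis of `l`, stays inside a block of `l` but mixes I
with its complement. Thus any I cutting a block yields a proper parabolic subgroup on which to test
cuspidality. -/
theorem not_le_levi_indCochar (l : Cocharacter n F) (I : Finset (Fin n)) {i j : Fin n} (hi : i ∈ I)
    (hj : j ∉ I) (hij : l.d i = l.d j) : ¬ l.levi ≤ (indCochar l I).levi := by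
  intro h
  have hne : i ≠ j := fun e => hj (e ▸ hi)
  have hc : (Pi.single j 1 : Fin n → F) i = 0 := by simp [hne]
  have hb : colOp i (Pi.single j 1 : Fin n → F) hc ∈ blockGroup F l.d :=
    colOp_mem_blockGroup fun a ha => by
      rw [Pi.single_apply, if_neg]
      rintro rfl
      exact ha hij
  have h1 := h (ofStd l ⟨_, hb⟩).2
  have h2 := ((indCochar l I).mem_levi_iff _).1 h1 i j (by simp [indCochar, hi, hj])
  have h3 : (indCochar l I).coords (ofStd l ⟨_, hb⟩)
      = (colOp i (Pi.single j 1 : Fin n → F) hc : Matrix (Fin n) (Fin n) F) :=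
    coords_conj l _
  rw [h3] at h2
  simp [colOp, vecMulVec_apply, hne] at h2

/-- The elements of the Levi subgroup in the unipotent radical attached to `I`. -/
def unipSet (l : Cocharacter n F) (I : Finset (Fin n)) : Set l.levi :=
  {u | (u : GL (Fin n) F) ∈ (indCochar l I).unipotentRadical}

/-- Block triangular means zero where the row weight exceeds the column weight. With weight 1 on I
and 0 elsewhere, the radical lives in rows outside I and columns in I. -/
theorem unip_sub_one_eq_zero (l : Cocharacter n F) (I : Finset (Fin n)) {u : l.levi}
    (hu : u ∈ unipSet l I) {i j : Fin n} (hij : ¬ (i ∉ I ∧ j ∈ I)) :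
    ((toStd l u : Matrix (Fin n) (Fin n) F) - 1) i j = 0 := by
  rw [← coords_eq, Matrix.sub_apply, sub_eq_zero]
  have h1 : ((indCochar l I).coords u).BlockTriangular (indCochar l I).d := hu.1
  by_cases hi : i ∈ I <;> by_cases hj : j ∈ I
  · exact hu.2 i j (by simp [indCochar, hi, hj])
  · have h2 : i ≠ j := fun e => hj (e ▸ hi)
    rw [Matrix.one_apply_ne h2]
    exact h1 (by simp [indCochar, hi, hj])
  · exact absurd ⟨hi, hj⟩ hij
  · exact hu.2 i j (by simp [indCochar, hi, hj])

/-- The central elements of a Levi subgroup with powers of `t` on the blocks. -/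
def blockCenter (l : Cocharacter n F) (t : Fˣ) :
    Multiplicative (Set.range l.d → ℤ) →* l.levi where
  toFun c := ofStd l ⟨diagGL (fun i => c.toAdd ⟨l.d i, i, rfl⟩) t, diagGL_mem_blockGroup _ _ _⟩
  map_one' := by
    rw [← map_one (ofStd l)]
    congr 1
    ext i j
    simp [diagGL_apply, Matrix.one_apply]
  map_mul' a b := by
    rw [← map_mul]
    congr 1
    apply Subtype.ext
    apply Units.ext
    change Matrix.diagonal _ = Matrix.diagonal _ * Matrix.diagonal _
    rw [Matrix.diagonal_mul_diagonal]
    congr 1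
    funext i
    rw [← Units.val_mul, ← _root_.zpow_add]
    rfl

theorem diagGL_mul_apply (a : Fin n → ℤ) (t : Fˣ) (g : GL (Fin n) F) (i j : Fin n) :
    ((diagGL a t * g : GL (Fin n) F) : Matrix (Fin n) (Fin n) F) i j
      = ((t ^ a i : Fˣ) : F) * g i j := by
  rw [Units.val_mul]
  exact Matrix.diagonal_mul _ _ _ _

theorem mul_diagGL_apply (a : Fin n → ℤ) (t : Fˣ) (g : GL (Fin n) F) (i j : Fin n) :
    ((g * diagGL a t : GL (Fin n) F) : Matrix (Fin n) (Fin n) F) i j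
      = g i j * ((t ^ a j : Fˣ) : F) := by
  rw [Units.val_mul]
  exact Matrix.mul_diagonal _ _ _ _

theorem blockCenter_commute (l : Cocharacter n F) (t : Fˣ)
    (c : Multiplicative (Set.range l.d → ℤ)) (g : l.levi) : Commute (blockCenter l t c) g := by
  apply toStd_injective l
  rw [map_mul, map_mul]
  change toStd l (ofStd l _) * _ = _ * toStd l (ofStd l _)
  rw [toStd_ofStd]
  ext i j
  rw [diagGL_mul_apply, mul_diagGL_apply, mul_comm]
  by_cases h : l.d i = l.d j
  · simp only [h]
  · rw [mem_blockGroup.1 (toStd_mem l g) i j h]; simp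

/-- Pigeonhole. If no cut of the values of `a` at one of the thresholds a j₀ + s C, 0 ≤ s ≤ n,
leaves a gap of C, each of the n + 1 windows of length C above them contains a value of `a`. The
windows are disjoint and there are only n indices. -/
theorem exists_gap (a : Fin n → ℤ) {C : ℤ} (hC : 0 ≤ C) {i₀ j₀ : Fin n}
    (h : n * C < a i₀ - a j₀) :
    ∃ I : Finset (Fin n), j₀ ∈ I ∧ i₀ ∉ I ∧ ∀ i ∉ I, ∀ j ∈ I, C ≤ a i - a j := by
  by_contra! hcon
  have key : ∀ s : Fin (n + 1), ∃ i, a j₀ + s * C < a i ∧ a i < a j₀ + s * C + C := by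
    intro s
    have hs : (s : ℤ) * C ≤ n * C := mul_le_mul_of_nonneg_right (by have := s.2; omega) hC
    have hs0 : 0 ≤ (s : ℤ) * C := by positivity
    obtain ⟨i, hi, j, hj, hij⟩ := hcon (Finset.univ.filter fun i => a i ≤ a j₀ + s * C)
      (by simpa using hs0) (by simp; omega)
    simp only [Finset.mem_filter, Finset.mem_univ, true_and, not_le] at hi hj
    exact ⟨i, hi, by omega⟩
  choose f hf hf' using key
  have hlt : ∀ s s' : Fin (n + 1), s < s' → f s ≠ f s' := by
    intro s s' hss e
    have h1 := hf' s
    have h2 := hf s'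
    rw [e] at h1
    have : ((s : ℤ) + 1) * C ≤ s' * C := mul_le_mul_of_nonneg_right (by
      have : (s : ℕ) < s' := hss
      omega) hC
    linarith
  have hinj : Function.Injective f := by
    intro s s' e
    rcases lt_trichotomy s s' with hh | hh | hh
    · exact absurd e (hlt _ _ hh)
    · exact hh
    · exact absurd e.symm (hlt _ _ hh)
  have := Fintype.card_le_of_injective f hinj
  simp at this

variable [ValuativeRel F] [TopologicalSpace F] [IsNonarchimedeanLocalField F]

/-- The congruence subgroups of a Levi subgroup. -/
noncomputable def leviCong (l : Cocharacter n F) (m : ℕ) : Subgroup l.levi :=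
  (congSubgroup F n m).comap (toStd l)

theorem mem_leviCong {l : Cocharacter n F} {m : ℕ} {g : l.levi} :
    g ∈ leviCong l m ↔ toStd l g ∈ congSubgroup F n m := Iff.rfl

theorem leviCong_antitone (l : Cocharacter n F) : Antitone (leviCong l) := fun _ _ h =>
  Subgroup.comap_mono (congSubgroup_anti h)

theorem conj_mem_leviCong {l : Cocharacter n F} {m : ℕ} {k g : l.levi} (hk : k ∈ leviCong l 0)
    (hg : g ∈ leviCong l m) : k * g * k⁻¹ ∈ leviCong l m := by
  rw [mem_leviCong, map_mul, map_mul, map_inv]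
  exact conj_mem_congSubgroup hk hg

theorem relIndex_leviCong_zero (l : Cocharacter n F) (m : ℕ) :
    (leviCong l m).relIndex (leviCong l 0) ≠ 0 := by
  rw [leviCong, Subgroup.relIndex_comap]
  intro h
  refine relIndex_congSubgroup_ne_zero (F := F) (n := n) m
    (Subgroup.relIndex_eq_zero_of_le_right ?_ h)
  exact Subgroup.map_comap_le _ _

/-- At positive level, raising to p-th powers goes one step deeper, so the finite quotients are
p-groups and their orders are nonzero in k. At level 0 the order of a finite reductive group would
intervene, whence `1 ≤ N`. -/
theorem relIndex_leviCong_cast_ne_zero {k : Type*} [Field k] {p ℓ : ℕ} (hp : p.Prime)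
    (hpF : (p : F) ∈ fracIdeal F 1) [CharP k ℓ] (hpℓ : ℓ ≠ p) (l : Cocharacter n F) {N : ℕ} (hN : 1 ≤ N)
    (m : ℕ) :
    ((leviCong l m).relIndex (leviCong l N) : k) ≠ 0 := by
  have : Fact p.Prime := ⟨hp⟩
  have hpk : (p : k) ≠ 0 := by
    rw [Ne, CharP.cast_eq_zero_iff k ℓ]
    intro h
    rcases (Nat.dvd_prime hp).1 h with h | h
    · exact CharP.char_ne_one k ℓ h
    · exact hpℓ h
  have hfin : (leviCong l m).relIndex (leviCong l N) ≠ 0 := fun h =>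
    relIndex_leviCong_zero l m
      (Subgroup.relIndex_eq_zero_of_le_right (leviCong_antitone l N.zero_le) h)
  have : Finite (leviCong l N ⧸ (leviCong l m).subgroupOf (leviCong l N)) :=
    Subgroup.index_ne_zero_iff_finite.1 hfin
  have : ((leviCong l m).subgroupOf (leviCong l N)).Normal :=
    ⟨fun x hx g => conj_mem_leviCong (leviCong_antitone l N.zero_le g.2) hx⟩
  have hpg : IsPGroup p (leviCong l N ⧸ (leviCong l m).subgroupOf (leviCong l N)) := by
    intro q
    obtain ⟨g, rfl⟩ := QuotientGroup.mk_surjective q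
    refine ⟨m, ?_⟩
    rw [← QuotientGroup.mk_pow, QuotientGroup.eq_one_iff, Subgroup.mem_subgroupOf, mem_leviCong]
    rw [Subgroup.coe_pow, map_pow]
    exact congSubgroup_anti (Nat.le_succ m) (pow_pow_mem_congSubgroup hpF (congSubgroup_anti hN g.2) m)
  obtain ⟨j, hj⟩ := IsPGroup.iff_card.1 hpg
  rw [Subgroup.relIndex, Subgroup.index, hj]
  push_cast
  exact pow_ne_zero _ hpk

variable {k V : Type*} [Field k] [AddCommGroup V] [Module k V]

theorem IsSmooth.exists_leviCong {l : Cocharacter n F} {π : Representation k l.levi V}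
    (h : IsSmooth π) (v : V) : ∃ m, ∀ g ∈ leviCong l m, π g v = v := by
  obtain ⟨U, hU, hUv⟩ := isOpen_induced_iff.1 (h v)
  have h1 : (1 : GL (Fin n) F) ∈ U := by
    have : (1 : l.levi) ∈ (Subtype.val ⁻¹' U : Set l.levi) := by rw [hUv]; simp
    exact this
  have h2 : (fun g : GL (Fin n) F => l.x * g * l.x⁻¹) ⁻¹' U ∈ nhds 1 :=
    (hU.preimage (by fun_prop)).mem_nhds (by simpa using h1)
  obtain ⟨m, hm⟩ := exists_congSubgroup_subset h2
  refine ⟨m, fun g hg => ?_⟩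
  have h3 := hm hg
  have h4 : g ∈ (Subtype.val ⁻¹' U : Set l.levi) := by
    rw [← ofStd_toStd l g]; exact h3
  rw [hUv] at h4
  exact h4

theorem orbit_finite_of_fixed {l : Cocharacter n F} {π : Representation k l.levi V} {m : ℕ} {v : V}
    (hm : ∀ g ∈ leviCong l m, π g v = v) : {w | ∃ g ∈ leviCong l 0, π g v = w}.Finite := by
  have : Finite (leviCong l 0 ⧸ (leviCong l m).subgroupOf (leviCong l 0)) :=
    Subgroup.index_ne_zero_iff_finite.1 (relIndex_leviCong_zero l m)
  refine (Set.finite_range fun q : leviCong l 0 ⧸ (leviCong l m).subgroupOf (leviCong l 0) =>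
    π (q.out : leviCong l 0) v).subset ?_
  rintro _ ⟨g, hg, rfl⟩
  refine ⟨QuotientGroup.mk ⟨g, hg⟩, apply_eq_of_inv_mul_fixed (hm _ ?_)⟩
  have := QuotientGroup.out_eq' (QuotientGroup.mk ⟨g, hg⟩ :
    leviCong l 0 ⧸ (leviCong l m).subgroupOf (leviCong l 0))
  rw [QuotientGroup.eq, Subgroup.mem_subgroupOf] at this
  exact this

theorem orbit_finite {l : Cocharacter n F} {π : Representation k l.levi V}
    (h : IsSmooth π) (v : V) : {w | ∃ g ∈ leviCong l 0, π g v = w}.Finite :=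
  have ⟨_, hm⟩ := h.exists_leviCong v
  orbit_finite_of_fixed hm

theorem eq_top_of_orbit {G : Type*} [Group G] {π : Representation k G V}
    (hirr : ∀ Y : Submodule k V, (∀ g, ∀ v ∈ Y, π g v ∈ Y) → Y = ⊥ ∨ Y = ⊤) {v : V} (hv : v ≠ 0)
    {Y : Submodule k V} (hY : ∀ g, π g v ∈ Y) : Y = ⊤ := by
  have h1 : Submodule.span k (Set.range fun g => π g v) ≤ Y := by
    rw [Submodule.span_le]
    rintro _ ⟨g, rfl⟩
    exact hY g
  rcases hirr (Submodule.span k (Set.range fun g => π g v)) (fun g w hw => by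
    have : Submodule.span k (Set.range fun g => π g v)
        ≤ (Submodule.span k (Set.range fun g => π g v)).comap (π g) := by
      rw [Submodule.span_le]
      rintro _ ⟨h, rfl⟩
      refine Submodule.subset_span ⟨g * h, ?_⟩
      simp
    exact this hw) with h | h
  · have : v ∈ Submodule.span k (Set.range fun g => π g v) :=
      Submodule.subset_span ⟨1, by simp⟩
    rw [h] at this
    exact absurd this hv
  · exact top_le_iff.1 (h ▸ h1)

theorem irreducible_stable {G : Type*} [Group G] {π : Representation k G V}
    (h : π.IsIrreducible) (Y : Submodule k V) (hY : ∀ g, ∀ v ∈ Y, π g v ∈ Y) : Y = ⊥ ∨ Y = ⊤ := by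
  rcases eq_bot_or_eq_top (⟨Y, hY⟩ : Subrepresentation π) with h | h
  · exact Or.inl (congrArg Subrepresentation.toSubmodule h)
  · exact Or.inr (congrArg Subrepresentation.toSubmodule h)

theorem irreducible_nontrivial {G : Type*} [Group G] {π : Representation k G V}
    (h : π.IsIrreducible) : Nontrivial V := by
  rw [← not_subsingleton_iff_nontrivial]
  intro hs
  refine bot_ne_top (α := Subrepresentation π) (Subrepresentation.toSubmodule_injective ?_)
  exact Subsingleton.elim _ _

end LeviGroup

/-! ### Frobenius reciprocity and vanishing of Jacquet modules. -/

section Jacquet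

variable {F : Type*} [Field F] {n : ℕ}
variable [ValuativeRel F] [TopologicalSpace F] [IsNonarchimedeanLocalField F]
variable {k V : Type*} [Field k] [AddCommGroup V] [Module k V]

/-- The Iwasawa decomposition of an element of a Levi subgroup. -/
theorem exists_iwasawa (l : Cocharacter n F) (I : Finset (Fin n)) (g : l.levi) :
    ∃ (m : ↥(l.levi ⊓ (indCochar l I).levi)) (u : l.levi) (κ : l.levi), u ∈ unipSet l I ∧
      κ ∈ leviCong l 0 ∧ g = Subgroup.inclusion inf_le_left m * u * κ := by
  -- Clearing the rows in I outside the columns in I is exactly membership in the parabolic subgroup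
  -- of `indCochar l I`.
  obtain ⟨κ, hκ, hz⟩ := exists_mul_eq_zero l.d I (toStd_mem l g)
  set k' : l.levi := ofStd l ⟨κ, hκ.2⟩ with hk'
  have hst : toStd l (g * k') = toStd l g * κ := by rw [map_mul, hk', toStd_ofStd]
  have hpar : ((g * k' : l.levi) : GL (Fin n) F) ∈ (indCochar l I).parabolic := by
    intro i j hij
    change l.coords _ i j = 0
    rw [coords_eq, hst]
    by_cases hi : i ∈ I <;> by_cases hj : j ∈ I <;> simp [indCochar, hi, hj] at hij
    exact hz i hi j hj
  obtain ⟨m, hm, hu, hme⟩ := exists_levi_unipotent _ hpar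
  have hml : m ∈ l.levi := by
    rw [Cocharacter.mem_levi_iff]
    intro i j hij
    have h1 : l.coords m i j = _ := hme i j
    rw [h1]
    split_ifs
    · exact (l.mem_levi_iff _).1 (g * k').2 i j hij
    · rfl
  refine ⟨⟨m, hml, hm⟩, ⟨m⁻¹ * ((g * k' : l.levi) : GL (Fin n) F),
    l.levi.mul_mem (l.levi.inv_mem hml) (g * k').2⟩, k'⁻¹, hu, inv_mem ?_, ?_⟩
  · rw [mem_leviCong, hk', toStd_ofStd]; exact hκ.1
  · apply Subtype.ext
    simp

/-- The stabiliser of a vector. -/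
def vectorStabilizer {G : Type*} [Group G] (π : Representation k G V) (v : V) : Subgroup G where
  carrier := {g | π g v = v}
  one_mem' := by simp
  mul_mem' := fun {a b} ha hb => by
    have ha : π a v = v := ha
    have hb : π b v = v := hb
    change π (a * b) v = v
    rw [map_mul, Module.End.mul_apply, hb, ha]
  inv_mem' := fun {a} ha => by
    have ha : π a v = v := ha
    change π a⁻¹ v = v
    conv_lhs => rw [← ha]
    rw [← Module.End.mul_apply, ← map_mul, inv_mul_cancel, map_one, Module.End.one_apply]

/-- The map to a parabolically induced representation given by Frobenius reciprocity. -/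
def frobeniusMap {H : Subgroup (GL (Fin n) F)} {π : Representation k H V} (hsm : IsSmooth π)
    (l : Cocharacter n F) {W : Type*} [AddCommGroup W] [Module k W]
    (ρ : Representation k ↥(H ⊓ l.levi) W) (q : V →ₗ[k] W)
    (hq : ∀ m v, q (π (Subgroup.inclusion inf_le_left m) v) = ρ m (q v))
    (hqu : ∀ (u : ↥(H ⊓ l.unipotentRadical)) v,
      q (π (Subgroup.inclusion inf_le_left u) v) = q v) :
    π.IntertwiningMap (parabolicInd H l ρ) where
  toFun v := ⟨fun h => q (π h v), fun m h => by beta_reduce; rw [map_mul, Module.End.mul_apply, hq],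
    fun u h => by beta_reduce; rw [map_mul, Module.End.mul_apply, hqu],
    vectorStabilizer π v, hsm v, fun h κ hκ => by
      have hκ : π κ v = v := hκ
      beta_reduce
      rw [map_mul, Module.End.mul_apply, hκ]⟩
  map_add' a b := by ext h; simp
  map_smul' c a := by ext h; simp
  isIntertwining' g := by
    ext v h
    change q (π h (π g v)) = q (π (h * g) v)
    rw [map_mul, Module.End.mul_apply]

theorem frobeniusMap_apply {H : Subgroup (GL (Fin n) F)} {π : Representation k H V}
    (hsm : IsSmooth π) (l : Cocharacter n F) {W : Type*} [AddCommGroup W] [Module k W]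
    (ρ : Representation k ↥(H ⊓ l.levi) W) (q : V →ₗ[k] W)
    (hq : ∀ m v, q (π (Subgroup.inclusion inf_le_left m) v) = ρ m (q v))
    (hqu : ∀ (u : ↥(H ⊓ l.unipotentRadical)) v,
      q (π (Subgroup.inclusion inf_le_left u) v) = q v) (v : V) (h : H) :
    (frobeniusMap hsm l ρ q hq hqu v).1 h = q (π h v) := rfl

/-- The restriction of a representation to a subgroup. -/
def restrictTo {G : Type*} [Group G] {H L : Subgroup G} (π : Representation k H V) (hL : L ≤ H) :
    Representation k L V :=
  π.comp (Subgroup.inclusion hL)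

theorem isSmooth_quotient {H L : Subgroup (GL (Fin n) F)} {π : Representation k H V}
    (hsm : IsSmooth π) (hL : L ≤ H) (Y : Submodule k V)
    (hY : ∀ g, Y ≤ Y.comap (restrictTo π hL g)) :
    IsSmooth ((restrictTo π hL).quotient Y hY) := by
  intro w
  obtain ⟨v, rfl⟩ := Submodule.mkQ_surjective Y w
  have hcont : Continuous (Subgroup.inclusion hL) :=
    Continuous.subtype_mk continuous_subtype_val _
  refine Subgroup.isOpen_of_mem_nhds (vectorStabilizer _ (Y.mkQ v)) (g := 1) ?_
  refine Filter.mem_of_superset (((hsm v).preimage hcont).mem_nhds (by simp)) fun g hg => ?_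
  have hg : π (Subgroup.inclusion hL g) v = v := hg
  exact congrArg Y.mkQ hg

/-- By Frobenius reciprocity q gives a map from π to the induced representation, injective or zero
by irreducibility. Cuspidality excludes injectivity, and evaluation at 1 recovers q. -/
theorem IsCuspidal.eq_zero_of_equivariant.{v} {V : Type v} [AddCommGroup V] [Module k V]
    {H : Subgroup (GL (Fin n) F)} {π : Representation k H V}
    (hirr : π.IsIrreducible) (hsm : IsSmooth π) (hc : IsCuspidal π) (l : Cocharacter n F)
    (hl : l.IsIn H) (hlH : ¬ H ≤ l.levi) {W : Type v} [AddCommGroup W] [Module k W]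
    (ρ : Representation k ↥(H ⊓ l.levi) W) (hρ : ρ.IsIrreducible) (hρsm : IsSmooth ρ)
    (q : V →ₗ[k] W) (hq : ∀ m v, q (π (Subgroup.inclusion inf_le_left m) v) = ρ m (q v))
    (hqu : ∀ (u : ↥(H ⊓ l.unipotentRadical)) v,
      q (π (Subgroup.inclusion inf_le_left u) v) = q v) : q = 0 := by
  have h0 := (hc l hl hlH W ρ hρ hρsm).1
  have h1 := (Representation.IsIrreducible.injective_or_eq_zero
    (frobeniusMap hsm l ρ q hq hqu)).resolve_left fun h => h0 ⟨_, h⟩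
  ext v
  have h2 : frobeniusMap hsm l ρ q hq hqu v = 0 := by rw [h1]; rfl
  have h3 := frobeniusMap_apply hsm l ρ q hq hqu v 1
  rw [h2, map_one, Module.End.one_apply] at h3
  exact h3.symm

/-- By the Iwasawa decomposition, the Jacquet module is generated over the smaller Levi subgroup by
the images of the finite orbit of one vector under integral matrices. A nonzero finitely generated
representation has an irreducible quotient. -/
theorem exists_jacquet_quotient {l : Cocharacter n F} {π : Representation k l.levi V}
    (hirr : π.IsIrreducible) (hsm : IsSmooth π) (I : Finset (Fin n))
    (htop : augSpan π (unipSet l I) ≠ ⊤) :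
    ∃ (Y : Submodule k V)
      (hY : ∀ g, Y ≤ Y.comap (restrictTo π (inf_le_left (b := (indCochar l I).levi)) g)),
      augSpan π (unipSet l I) ≤ Y ∧ Y ≠ ⊤ ∧
      ((restrictTo π (inf_le_left (b := (indCochar l I).levi))).quotient Y hY).IsIrreducible := by
  have := irreducible_nontrivial hirr
  obtain ⟨v₀, hv₀⟩ := exists_ne (0 : V)
  have h1 : ∀ (m : ↥(l.levi ⊓ (indCochar l I).levi)), ∀ v ∈ augSpan π (unipSet l I),
      restrictTo π (inf_le_left (b := (indCochar l I).levi)) m v ∈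
        augSpan π (unipSet l I) := by
    intro m v hv
    exact apply_mem_augSpan (h := Subgroup.inclusion inf_le_left m)
      (fun u hu => conj_mem_unipotentRadical (indCochar l I) m.2.2 hu) hv
  refine exists_irreducible_quotient _ h1 htop _ (orbit_finite hsm v₀) ?_
  intro Y hXY hY hS
  refine eq_top_of_orbit (irreducible_stable hirr) hv₀ fun g => ?_
  obtain ⟨m, u, κ, hu, hκ, rfl⟩ := exists_iwasawa l I g
  rw [map_mul, map_mul, Module.End.mul_apply, Module.End.mul_apply]
  refine hY m _ ?_
  have h2 : π κ v₀ ∈ Y := hS ⟨κ, hκ, rfl⟩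
  have h3 := add_mem (hXY (sub_mem_augSpan hu (π κ v₀))) h2
  rwa [sub_add_cancel] at h3

/-- The Jacquet modules of a cuspidal representation vanish. -/
theorem IsCuspidal.augSpan_eq_top {l : Cocharacter n F} {π : Representation k l.levi V}
    (hirr : π.IsIrreducible) (hsm : IsSmooth π) (hc : IsCuspidal π) (I : Finset (Fin n))
    {i j : Fin n} (hi : i ∈ I) (hj : j ∉ I) (hij : l.d i = l.d j) :
    augSpan π (unipSet l I) = ⊤ := by
  by_contra htop
  obtain ⟨Y, hY, hXY, hYtop, hYirr⟩ := exists_jacquet_quotient hirr hsm I htop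
  have hYsm := isSmooth_quotient hsm inf_le_left Y hY
  generalize hρ : (restrictTo π (inf_le_left (b := (indCochar l I).levi))).quotient Y hY = ρ
    at hYirr hYsm
  have hq1 : ∀ m v, Y.mkQ (π (Subgroup.inclusion inf_le_left m) v) = ρ m (Y.mkQ v) := by
    intro m v
    rw [← hρ]; rfl
  have hq2 : ∀ (u : ↥(l.levi ⊓ (indCochar l I).unipotentRadical)) v,
      Y.mkQ (π (Subgroup.inclusion inf_le_left u) v) = Y.mkQ v := by
    intro u v
    have hu : Subgroup.inclusion inf_le_left u ∈ unipSet l I := u.2.2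
    have h := hXY (sub_mem_augSpan hu v)
    rw [← sub_eq_zero, ← map_sub]
    exact (Submodule.Quotient.mk_eq_zero Y).2 h
  -- The projection onto an irreducible quotient of the Jacquet module must vanish, although Y is
  -- proper.
  have hq := hc.eq_zero_of_equivariant hirr hsm _ (indCochar_isIn l I)
    (not_le_levi_indCochar l I hi hj hij) ρ hYirr hYsm Y.mkQ hq1 hq2
  refine hYtop (Submodule.eq_top_iff'.2 fun v => (Submodule.Quotient.mk_eq_zero Y).1 ?_)
  exact LinearMap.congr_fun hq v

end Jacquet

/-! ### Central elements act by scalars on cuspidal representations. -/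

section CentralCharacter

variable {F : Type*} [Field F] {n : ℕ}
/-- The diagonal elements of a Levi subgroup. -/
def diagLevi (l : Cocharacter n F) (t : Fˣ) (a : Fin n → ℤ) : l.levi :=
  ofStd l ⟨diagGL a t, diagGL_mem_blockGroup _ _ _⟩

theorem diagLevi_eq_mul (l : Cocharacter n F) (t : Fˣ) (a : Fin n → ℤ)
    (z : Set.range l.d → ℤ) : diagLevi l t a = blockCenter l t (Multiplicative.ofAdd z) *
      diagLevi l t (fun i => a i - z ⟨l.d i, i, rfl⟩) := by
  apply toStd_injective l
  rw [map_mul]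
  change _ = toStd l (ofStd l _) * _
  rw [diagLevi, diagLevi, toStd_ofStd, toStd_ofStd, toStd_ofStd]
  ext i j
  rw [diagGL_mul_apply, diagGL_apply, diagGL_apply]
  split_ifs
  · rw [← Units.val_mul, ← _root_.zpow_add]
    congr 2
    simp
  · simp

variable [ValuativeRel F] [TopologicalSpace F] [IsNonarchimedeanLocalField F]
variable {k V : Type*} [Field k] [AddCommGroup V] [Module k V]

/-- The elements of the unipotent radical attached to `I` with bounded entries. -/
def unipBdd (l : Cocharacter n F) (I : Finset (Fin n)) (c : ℕ) : Set l.levi :=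
  {u | u ∈ unipSet l I ∧
    (∀ i j, ((toStd l u : Matrix (Fin n) (Fin n) F) - 1) i j ∈ fracIdeal F (-(c : ℤ))) ∧
    ∀ i j, ((toStd l u⁻¹ : Matrix (Fin n) (Fin n) F) - 1) i j ∈ fracIdeal F (-(c : ℤ))}

theorem unipBdd_mono (l : Cocharacter n F) (I : Finset (Fin n)) {a b : ℕ} (h : a ≤ b) :
    unipBdd l I a ⊆ unipBdd l I b := fun _ hu =>
  ⟨hu.1, fun i j => fracIdeal_anti (by omega) (hu.2.1 i j),
    fun i j => fracIdeal_anti (by omega) (hu.2.2 i j)⟩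

theorem exists_entries_mem_fracIdeal (A : Matrix (Fin n) (Fin n) F) :
    ∃ c : ℕ, ∀ i j, A i j ∈ fracIdeal F (-(c : ℤ)) := by
  choose c hc using fun i j => exists_mem_fracIdeal (A i j)
  refine ⟨Finset.univ.sup fun i => Finset.univ.sup fun j => c i j,
    fun i j => fracIdeal_anti ?_ (hc i j)⟩
  have h1 : c i j ≤ Finset.univ.sup fun j => c i j :=
    Finset.le_sup (f := fun j => c i j) (Finset.mem_univ j)
  have h2 := Finset.le_sup (f := fun i => Finset.univ.sup fun j => c i j) (Finset.mem_univ i)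
  have := h1.trans h2
  omega

/-- A vector of the span involves only finitely many unipotent elements, whose entries have a common
bound. -/
theorem exists_mem_augSpan_unipBdd {l : Cocharacter n F} {π : Representation k l.levi V}
    {I : Finset (Fin n)} {v : V} (hv : v ∈ augSpan π (unipSet l I)) :
    ∃ c, v ∈ augSpan π (unipBdd l I c) := by
  refine Submodule.span_induction ?_ ⟨0, zero_mem _⟩ ?_ ?_ hv
  · rintro _ ⟨u, hu, w, rfl⟩
    obtain ⟨a, ha⟩ := exists_entries_mem_fracIdeal ((toStd l u : Matrix (Fin n) (Fin n) F) - 1)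
    obtain ⟨b, hb⟩ := exists_entries_mem_fracIdeal ((toStd l u⁻¹ : Matrix (Fin n) (Fin n) F) - 1)
    refine ⟨max a b, sub_mem_augSpan (A := unipBdd l I (max a b)) ⟨hu, fun i j => fracIdeal_anti ?_ (ha i j),
      fun i j => fracIdeal_anti ?_ (hb i j)⟩ w⟩ <;> push_cast <;> omega
  · rintro x y - - ⟨a, ha⟩ ⟨b, hb⟩
    exact ⟨max a b, add_mem (augSpan_mono (unipBdd_mono l I (le_max_left a b)) ha)
      (augSpan_mono (unipBdd_mono l I (le_max_right a b)) hb)⟩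
  · rintro c x - ⟨a, ha⟩
    exact ⟨a, Submodule.smul_mem _ c ha⟩

/-- Conjugation multiplies the entry (i, j) by t ^ (a i - a j). Off the diagonal only i ∉ I, j ∈ I
matters, where this gains c + N and outweighs the denominator bound c. -/
theorem diagLevi_conj_mem {t : Fˣ} (ht : ordVal F (t : F) = WithZero.exp (-1))
    (l : Cocharacter n F) {I : Finset (Fin n)} {c N : ℕ} {a : Fin n → ℤ}
    (ha : ∀ i ∉ I, ∀ j ∈ I, (c + N : ℤ) ≤ a i - a j) {u : l.levi} (hu : u ∈ unipBdd l I c) :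
    diagLevi l t a * u * (diagLevi l t a)⁻¹ ∈ leviCong l N := by
  have key : ∀ u : l.levi, u ∈ unipSet l I →
      (∀ i j, ((toStd l u : Matrix (Fin n) (Fin n) F) - 1) i j ∈ fracIdeal F (-(c : ℤ))) →
      ∀ i j, ((toStd l (diagLevi l t a * u * (diagLevi l t a)⁻¹) :
        Matrix (Fin n) (Fin n) F) - 1) i j ∈ fracIdeal F (N : ℤ) := by
    intro u hu hb i j
    have h1 : (toStd l (diagLevi l t a * u * (diagLevi l t a)⁻¹) : Matrix (Fin n) (Fin n) F) - 1
        = diagonal (fun i => ((t ^ a i : Fˣ) : F)) * ((toStd l u : Matrix (Fin n) (Fin n) F) - 1)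
          * diagonal (fun i => ((t ^ (-a i) : Fˣ) : F)) := by
      rw [map_mul, map_mul, map_inv, diagLevi, toStd_ofStd, mul_sub, sub_mul, mul_one]
      congr 1
      exact (diagGL a t).mul_inv.symm
    rw [h1, Matrix.mul_diagonal, Matrix.diagonal_mul]
    by_cases hij : i ∉ I ∧ j ∈ I
    · have := ha i hij.1 j hij.2
      exact mul_mem_fracIdeal' (mul_mem_fracIdeal (zpow_mem_fracIdeal ht _) (hb i j))
        (zpow_mem_fracIdeal ht _) (by omega)
    · rw [unip_sub_one_eq_zero l I hu hij, mul_zero, zero_mul]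
      exact zero_mem _
  refine ⟨key u hu.1 hu.2.1, ?_⟩
  rw [← map_inv]
  have : (diagLevi l t a * u * (diagLevi l t a)⁻¹)⁻¹
      = diagLevi l t a * u⁻¹ * (diagLevi l t a)⁻¹ := by group
  rw [this]
  exact key u⁻¹ ((indCochar l I).unipotentRadical.inv_mem hu.1) hu.2.2

/-- Each Jacquet module attached to such an I vanishes, so every s has a bound for each I; there are
finitely many I and s. -/
theorem exists_uniform_bound {l : Cocharacter n F} {π : Representation k l.levi V}
    (hirr : π.IsIrreducible) (hsm : IsSmooth π) (hc : IsCuspidal π) {S : Set V} (hS : S.Finite) :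
    ∃ C : ℕ, ∀ I : Finset (Fin n), (∃ i ∈ I, ∃ j ∉ I, l.d i = l.d j) → ∀ s ∈ S,
      s ∈ augSpan π (unipBdd l I C) := by
  have h : ∀ I : Finset (Fin n), ∀ s : V, ∃ c : ℕ, (∃ i ∈ I, ∃ j ∉ I, l.d i = l.d j) →
      s ∈ augSpan π (unipBdd l I c) := by
    intro I s
    by_cases hI : ∃ i ∈ I, ∃ j ∉ I, l.d i = l.d j
    · obtain ⟨i, hi, j, hj, hij⟩ := hI
      have hs : s ∈ augSpan π (unipSet l I) := by
        rw [hc.augSpan_eq_top hirr hsm I hi hj hij]; trivial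
      obtain ⟨c, hc⟩ := exists_mem_augSpan_unipBdd hs
      exact ⟨c, fun _ => hc⟩
    · exact ⟨0, fun h => absurd h hI⟩
  choose c hc using h
  refine ⟨Finset.univ.sup fun I => hS.toFinset.sup fun s => c I s, fun I hI s hs =>
    augSpan_mono (unipBdd_mono l I ?_) (hc I s hI)⟩
  exact (Finset.le_sup (f := fun s => c I s) (hS.mem_toFinset.2 hs)).trans
    (Finset.le_sup (f := fun I => hS.toFinset.sup fun s => c I s) (Finset.mem_univ I))

/-- The central elements act by scalars on an irreducible cuspidal representation. -/
theorem IsCuspidal.exists_scalar_blockCenter [IsAlgClosed k] {p ℓ : ℕ} (hp : p.Prime)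
    (hpF : (p : F) ∈ fracIdeal F 1) [CharP k ℓ] (hpℓ : ℓ ≠ p)
    {t : Fˣ} (ht : ordVal F (t : F) = WithZero.exp (-1)) {l : Cocharacter n F}
    {π : Representation k l.levi V} (hirr : π.IsIrreducible) (hsm : IsSmooth π)
    (hc : IsCuspidal π) (z : Multiplicative (Set.range l.d → ℤ)) :
    ∃ s : k, ∀ v, π (blockCenter l t z) v = s • v := by
  have hirr' := irreducible_stable hirr
  have := irreducible_nontrivial hirr
  obtain ⟨w₀, hw₀⟩ := exists_ne (0 : V)
  -- The level is made positive so that the indices below it are powers of p.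
  obtain ⟨N, hN, hNw⟩ : ∃ N, 1 ≤ N ∧ ∀ g ∈ leviCong l N, π g w₀ = w₀ := by
    obtain ⟨m, hm⟩ := hsm.exists_leviCong w₀
    exact ⟨max m 1, le_max_right _ _, fun g hg => hm g (leviCong_antitone l (le_max_left _ _) hg)⟩
  -- The fixed vector w₀ ≠ 0 survives in the coinvariants of the congruence subgroup of level N.
  have hXtop : augSpan π (leviCong l N : Set l.levi) ≠ ⊤ := fun htop =>
    hw₀ (eq_zero_of_fixed_of_mem_augSpan (leviCong l N) (leviCong l) (leviCong_antitone l)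
      (fun m g hg x hx => conj_mem_leviCong (leviCong_antitone l N.zero_le hg) hx)
      (relIndex_leviCong_cast_ne_zero hp hpF hpℓ l hN) hsm.exists_leviCong hNw
      (by rw [htop]; trivial))
  have hS := orbit_finite hsm w₀
  obtain ⟨C, hC⟩ := exists_uniform_bound hirr hsm hc hS
  set S := {w | ∃ g ∈ leviCong l 0, π g w₀ = w}
  -- The threshold in `exists_gap` for a gap of C + N: C undoes the denominators in `unipBdd`, and N
  -- reaches the level of the congruence subgroup.
  let B : ℤ := n * (C + N)
  let box : Set (Fin n → ℤ) := Set.Icc (fun _ => -B) (fun _ => B)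
  have hbox : box.Finite := Set.finite_Icc _ _
  let S₂ : Set V := ⋃ b ∈ box, ⋃ s ∈ S, {w | ∃ g ∈ leviCong l 0, π g (π (diagLevi l t b) s) = w}
  have hS₂ : S₂.Finite := hbox.biUnion fun b _ => hS.biUnion fun s _ => orbit_finite hsm _
  refine exists_scalar_of_central (blockCenter l t) (blockCenter_commute l t) hirr'
    (augSpan π (leviCong l N : Set l.levi)) (fun c v hv => apply_mem_augSpan (fun g hg => ?_) hv)
    hXtop S₂ hS₂ (fun Y hXY hY hSY => eq_top_of_orbit hirr' hw₀ fun g => ?_) z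
  · rwa [(blockCenter_commute l t c g).eq, mul_inv_cancel_right]
  obtain ⟨k₁, hk₁, k₂, hk₂, a, ha⟩ := exists_cartan ht l.d (toStd_mem l g)
  obtain ⟨κ₁, hκ₁, κ₂, hκ₂, hg⟩ : ∃ κ₁ ∈ leviCong l 0, ∃ κ₂ ∈ leviCong l 0,
      g = κ₁ * diagLevi l t a * κ₂ := by
    refine ⟨ofStd l ⟨k₁, hk₁.2⟩, ?_, ofStd l ⟨k₂, hk₂.2⟩, ?_, toStd_injective l ?_⟩
    · rw [mem_leviCong, toStd_ofStd]; exact hk₁.1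
    · rw [mem_leviCong, toStd_ofStd]; exact hk₂.1
    · rw [map_mul, map_mul, diagLevi, toStd_ofStd, toStd_ofStd, toStd_ofStd, ha]
  rw [hg, map_mul, map_mul, Module.End.mul_apply, Module.End.mul_apply]
  have hs : π κ₂ w₀ ∈ S := ⟨κ₂, hκ₂, rfl⟩
  generalize π κ₂ w₀ = s at hs
  -- Either a varies by more than B within a block, and the vector dies in the coinvariants, or a
  -- lies in a finite box up to a central element.
  by_cases hgap : ∃ i₀ j₀, l.d i₀ = l.d j₀ ∧ B < a i₀ - a j₀
  · obtain ⟨i₀, j₀, hij, hgap⟩ := hgap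
    obtain ⟨I, hjI, hiI, hI⟩ := exists_gap a (by positivity) hgap
    have h1 := hC I ⟨j₀, hjI, i₀, hiI, hij.symm⟩ s hs
    have h2 : π (diagLevi l t a) s ∈ augSpan π (leviCong l N : Set l.levi) :=
      apply_mem_augSpan (fun u hu => diagLevi_conj_mem ht l hI hu) h1
    exact hXY (apply_mem_augSpan (fun g hg => conj_mem_leviCong hκ₁ hg) h2)
  · push Not at hgap
    -- The central factor is the value of a at one chosen index of each block; what remains is
    -- bounded by B.
    let r : Set.range l.d → ℤ := fun x => a x.2.choose
    have hr : ∀ i, l.d (Set.mem_range_self (f := l.d) i).choose = l.d i := fun i =>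
      (Set.mem_range_self (f := l.d) i).choose_spec
    rw [diagLevi_eq_mul l t a r, map_mul, Module.End.mul_apply, ← Module.End.mul_apply, ← map_mul,
      ← (blockCenter_commute l t _ κ₁).eq, map_mul, Module.End.mul_apply]
    refine hY _ _ (hSY ?_)
    simp only [S₂, Set.mem_iUnion]
    refine ⟨_, ⟨fun i => ?_, fun i => ?_⟩, s, hs, κ₁, hκ₁, rfl⟩
    · have := hgap _ _ (hr i)
      change -B ≤ a i - a (Set.mem_range_self (f := l.d) i).choose
      linarith
    · have := hgap _ _ (hr i).symm
      change a i - a (Set.mem_range_self (f := l.d) i).choose ≤ B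
      linarith

end CentralCharacter

/-! ### Common eigenvectors of commuting operators. -/

section Eigenvector

variable {k G V : Type*} [Field k] [Group G] [AddCommGroup V] [Module k V]

/-- Commuting operators on a nonzero finite-dimensional space have a common eigenvector. -/
theorem exists_common_eigenvector [IsAlgClosed k] (τ : Representation k G V) (Y₀ : Submodule k V)
    [FiniteDimensional k Y₀] (hY₀ : Y₀ ≠ ⊥) (hst : ∀ g, ∀ v ∈ Y₀, τ g v ∈ Y₀)
    (hcomm : ∀ g h, ∀ v ∈ Y₀, τ g (τ h v) = τ h (τ g v)) :
    ∃ v ∈ Y₀, v ≠ 0 ∧ ∃ χ : G →* kˣ, ∀ g, τ g v = ((χ g : kˣ) : k) • v := by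
  -- On a nonzero stable subspace of least dimension each operator is a scalar: its eigenspaces
  -- there are stable because the operators commute.
  have hex : ∃ d : ℕ, ∃ Y ≤ Y₀, Y ≠ ⊥ ∧ (∀ g, ∀ v ∈ Y, τ g v ∈ Y) ∧ Module.finrank k Y = d :=
    ⟨_, Y₀, le_rfl, hY₀, hst, rfl⟩
  classical
  obtain ⟨Y, hYle, hY, hYst, hYd⟩ := Nat.find_spec hex
  have hmin := fun d (hd : d < Nat.find hex) => Nat.find_min hex hd
  have hYfin : FiniteDimensional k Y := Submodule.finiteDimensional_of_le hYle
  have hYnt : Nontrivial Y := Submodule.nontrivial_iff_ne_bot.2 hY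
  have hscal : ∀ g, ∃ s : k, ∀ v ∈ Y, τ g v = s • v := by
    intro g
    obtain ⟨s, hs⟩ := Module.End.exists_eigenvalue ((τ g).restrict (hYst g))
    obtain ⟨v, hv⟩ := hs.exists_hasEigenvector
    refine ⟨s, fun w hw => ?_⟩
    let E : Submodule k V := Y ⊓ LinearMap.ker (τ g - s • LinearMap.id)
    have hE : ∀ w, w ∈ E ↔ w ∈ Y ∧ τ g w = s • w := fun w => by
      simp [E, sub_eq_zero]
    have hEY : E ≤ Y := inf_le_left
    have hE0 : E ≠ ⊥ := by
      intro h
      have h1 : (v : V) ∈ E := (hE v).2 ⟨v.2, congrArg Subtype.val hv.apply_eq_smul⟩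
      rw [h, Submodule.mem_bot] at h1
      exact hv.2 (Subtype.ext h1)
    have hEst : ∀ h, ∀ v ∈ E, τ h v ∈ E := by
      intro h v hv
      obtain ⟨h1, h2⟩ := (hE v).1 hv
      refine (hE _).2 ⟨hYst h v h1, ?_⟩
      rw [hcomm g h v (hYle h1), h2, map_smul]
    have hEeq : E = Y := by
      refine Submodule.eq_of_le_of_finrank_le hEY ?_
      by_contra hlt
      push Not at hlt
      exact hmin _ (hYd ▸ hlt) ⟨E, hEY.trans hYle, hE0, hEst, rfl⟩
    exact ((hE w).1 (hEeq ▸ hw)).2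
  obtain ⟨⟨v, hvY⟩, hv⟩ := exists_ne (0 : Y)
  have hv0 : v ≠ 0 := fun h => hv (Subtype.ext h)
  choose s hs using hscal
  have hinj : ∀ a b : k, a • v = b • v → a = b := fun a b h => smul_left_injective k hv0 h
  let f : G →* k :=
    { toFun := s
      map_one' := hinj _ _ (by rw [← hs 1 v hvY]; simp)
      map_mul' := fun g h => hinj _ _ (by
        rw [← hs _ v hvY, map_mul, Module.End.mul_apply, hs h v hvY, map_smul, hs g v hvY, smul_smul,
          mul_comm]) }
  exact ⟨v, hYle hvY, hv0, f.toHomUnits, fun g => hs g v hvY⟩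

end Eigenvector

/-! ### Sections of the determinant and finiteness of orbits. -/

section Determinant

variable {F : Type*} [Field F] {n : ℕ}

/-- The diagonal matrix of determinant `u` in a Levi subgroup with one nontrivial entry. -/
def detSection (l : Cocharacter n F) (i₀ : Fin n) : Fˣ →* l.levi where
  toFun u := diagLevi l u (Pi.single i₀ 1)
  map_one' := by
    apply toStd_injective l
    rw [diagLevi, toStd_ofStd, map_one]
    ext i j
    simp [diagGL_apply, Matrix.one_apply]
  map_mul' u v := by
    apply toStd_injective l
    rw [map_mul, diagLevi, diagLevi, diagLevi, toStd_ofStd, toStd_ofStd, toStd_ofStd]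
    ext i j
    rw [diagGL_mul_apply, diagGL_apply, diagGL_apply]
    split_ifs
    · rw [mul_zpow, Units.val_mul]
    · simp

theorem det_ofStd (l : Cocharacter n F) (g : blockGroup F l.d) :
    Matrix.GeneralLinearGroup.det (ofStd l g : GL (Fin n) F)
      = Matrix.GeneralLinearGroup.det (g : GL (Fin n) F) := by
  rw [coe_ofStd, map_mul, map_mul, map_inv, mul_comm, inv_mul_cancel_left]

theorem det_diagGL (a : Fin n → ℤ) (t : Fˣ) :
    Matrix.GeneralLinearGroup.det (diagGL a t) = ∏ i, t ^ a i := by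
  apply Units.ext
  rw [Units.coe_prod]
  exact Matrix.det_diagonal

theorem det_detSection (l : Cocharacter n F) (i₀ : Fin n) (u : Fˣ) :
    Matrix.GeneralLinearGroup.det (detSection l i₀ u : GL (Fin n) F) = u := by
  change Matrix.GeneralLinearGroup.det (ofStd l _ : GL (Fin n) F) = u
  rw [det_ofStd, det_diagGL, Finset.prod_eq_single i₀]
  · simp
  · intro b _ hb; simp [hb]
  · simp

theorem det_blockCenter_one (l : Cocharacter n F) (t : Fˣ) :
    Matrix.GeneralLinearGroup.det
      (blockCenter l t (Multiplicative.ofAdd fun _ => 1) : GL (Fin n) F) = t ^ n := by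
  change Matrix.GeneralLinearGroup.det (ofStd l _ : GL (Fin n) F) = _
  rw [det_ofStd, det_diagGL]
  simp

variable [ValuativeRel F] [TopologicalSpace F] [IsNonarchimedeanLocalField F]

theorem detSection_mem_leviCong (l : Cocharacter n F) (i₀ : Fin n) {m : ℕ} {u : Fˣ}
    (hu : (u : F) - 1 ∈ fracIdeal F m) (hu' : ((u⁻¹ : Fˣ) : F) - 1 ∈ fracIdeal F m) :
    detSection l i₀ u ∈ leviCong l m := by
  have key : ∀ u : Fˣ, (u : F) - 1 ∈ fracIdeal F m → ∀ i j,
      ((toStd l (detSection l i₀ u) : Matrix (Fin n) (Fin n) F) - 1) i j ∈ fracIdeal F m := by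
    intro u hu i j
    change ((toStd l (ofStd l _) : Matrix (Fin n) (Fin n) F) - 1) i j ∈ _
    rw [toStd_ofStd, Matrix.sub_apply, diagGL_apply, Matrix.one_apply]
    by_cases h : i = j
    · by_cases h' : i = i₀
      · subst h'; simpa [h] using hu
      · subst h; simp [h', zero_mem]
    · simp [h, zero_mem]
  refine ⟨key u hu, ?_⟩
  rw [← map_inv, ← map_inv]
  exact key u⁻¹ hu'

variable {k V : Type*} [Field k] [AddCommGroup V] [Module k V]

/-- The orbit of a smooth vector is, up to scalars and elements of determinant one, finite, if the
scalar matrices act by scalars. -/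
theorem exists_finite_orbit_reps {t : Fˣ} (ht : ordVal F (t : F) = WithZero.exp (-1))
    {l : Cocharacter n F} (i₀ : Fin n) {σ : Representation k l.levi V} {m : ℕ} {w : V}
    (hm : ∀ g ∈ leviCong l m, σ g w = w) {c : k}
    (hc : ∀ v, σ (blockCenter l t (Multiplicative.ofAdd fun _ => 1)) v = c • v) :
    ∃ S : Set V, S.Finite ∧ ∀ g, ∃ g' : l.levi,
      Matrix.GeneralLinearGroup.det (g' : GL (Fin n) F) = 1 ∧ ∃ s : k, ∃ v ∈ S,
        σ g w = s • σ g' v := by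
  set z := blockCenter l t (Multiplicative.ofAdd fun _ => 1) with hz
  have hzq : ∀ q : ℤ, ∃ s : k, ∀ v, σ (z ^ q) v = s • v := by
    have hnat : ∀ q : ℕ, ∀ v, σ (z ^ q) v = c ^ q • v := by
      intro q
      induction q with
      | zero => simp
      | succ q ih =>
        intro v
        rw [pow_succ, map_mul, Module.End.mul_apply, hc, map_smul, ih, smul_smul, pow_succ, mul_comm]
    have hcinv : ∀ v, v = c • σ z⁻¹ v := by
      intro v
      rw [← hc, ← Module.End.mul_apply, ← map_mul]; simp
    intro q
    obtain ⟨q, rfl | rfl⟩ := q.eq_nat_or_neg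
    · exact ⟨c ^ q, fun v => by rw [zpow_natCast, hnat]⟩
    · refine ⟨(c ^ q)⁻¹, fun v => ?_⟩
      -- Since z is invertible, c ^ q = 0 is possible only on the zero space, where any scalar
      -- serves.
      by_cases h0 : c ^ q = 0
      · have hv : v = 0 := by
          have h1 := hnat q (σ (z ^ q)⁻¹ v)
          rw [← Module.End.mul_apply, ← map_mul, h0] at h1
          simpa using h1
        simp [hv]
      · rw [eq_inv_smul_iff₀ h0, ← hnat, ← Module.End.mul_apply, ← map_mul]
        simp
  -- The powers t ^ r, r < n, represent the orders of determinants modulo det z = t ^ n; units are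
  -- absorbed by the integral matrices, under which w has a finite orbit.
  refine ⟨⋃ r ∈ Finset.range n, (fun v => σ (detSection l i₀ (t ^ r)) v) ''
    {v | ∃ g ∈ leviCong l 0, σ g w = v},
    (Finset.finite_toSet _).biUnion fun r _ => (orbit_finite_of_fixed hm).image _, fun g => ?_⟩
  obtain ⟨a, u, hau, hu, hu'⟩ := exists_eq_zpow_mul ht
    (Matrix.GeneralLinearGroup.det (g : GL (Fin n) F))
  have hn : (0 : ℤ) < n := by have := i₀.pos; omega
  obtain ⟨s, hs⟩ := hzq (a / n)
  set κ := detSection l i₀ u with hκ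
  have hκm : κ ∈ leviCong l 0 := detSection_mem_leviCong l i₀
    (sub_mem hu one_mem_fracIdeal) (sub_mem hu' one_mem_fracIdeal)
  set r := (a % n).toNat with hr
  have hrn : (r : ℤ) = a % n := Int.toNat_of_nonneg (Int.emod_nonneg _ hn.ne')
  -- A standard element with the determinant of g: writing g = (g h⁻¹) h leaves a factor of
  -- determinant one.
  set h := z ^ (a / n) * detSection l i₀ (t ^ r) * κ with hh
  have hdet : Matrix.GeneralLinearGroup.det (h : GL (Fin n) F)
      = Matrix.GeneralLinearGroup.det (g : GL (Fin n) F) := by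
    rw [hau, hh, Subgroup.coe_mul, Subgroup.coe_mul, map_mul, map_mul, det_detSection,
      det_detSection, Subgroup.coe_zpow, map_zpow, det_blockCenter_one]
    congr 1
    rw [← zpow_natCast t n, ← _root_.zpow_mul, ← zpow_natCast t r, ← _root_.zpow_add, hrn,
      Int.mul_ediv_add_emod]
  refine ⟨g * h⁻¹, ?_, s, σ (detSection l i₀ (t ^ r)) (σ κ w), ?_, ?_⟩
  · rw [Subgroup.coe_mul, Subgroup.coe_inv, map_mul, map_inv, hdet, mul_inv_cancel]
  · simp only [Set.mem_iUnion]
    refine ⟨r, ?_, ⟨_, ⟨κ, hκm, rfl⟩, rfl⟩⟩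
    have := Int.emod_lt_of_pos a hn
    simp only [Finset.mem_range]
    omega
  · rw [← map_smul, ← hs, ← Module.End.mul_apply, ← Module.End.mul_apply, ← Module.End.mul_apply,
      ← map_mul, ← map_mul, ← map_mul]
    congr 2
    rw [hh]; group

end Determinant

/-! ### From equivariance under determinant one to an isomorphism with a twist. -/

section Twist

variable {F : Type*} [Field F] {n : ℕ} {k V₁ V₂ : Type*} [Field k]
  [AddCommGroup V₁] [Module k V₁] [AddCommGroup V₂] [Module k V₂]

/-- A nonzero map which is equivariant up to `χ ∘ det` is an isomorphism onto the twist. -/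
theorem nonempty_equiv_twistDet {M : Subgroup (GL (Fin n) F)} {π₁ : Representation k M V₁}
    {π₂ : Representation k M V₂} (h₁ : π₁.IsIrreducible) (h₂ : π₂.IsIrreducible)
    (χ : Fˣ →* kˣ) (ψ : V₁ →ₗ[k] V₂) (hψ : ψ ≠ 0)
    (hχ : ∀ (g : M) v, ψ (π₁ g v) =
      ((χ (Matrix.GeneralLinearGroup.det (g : GL (Fin n) F)) : kˣ) : k) • π₂ g (ψ v)) :
    Nonempty (π₁.Equiv (twistDet π₂ χ)) := by
  have hker : LinearMap.ker ψ = ⊥ := by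
    refine (irreducible_stable h₁ _ fun g v hv => ?_).resolve_right fun h =>
      hψ (LinearMap.ker_eq_top.1 h)
    rw [LinearMap.mem_ker] at hv ⊢
    rw [hχ, hv, map_zero, smul_zero]
  have hrange : LinearMap.range ψ = ⊤ := by
    refine (irreducible_stable h₂ _ fun g v hv => ?_).resolve_left fun h =>
      hψ (LinearMap.range_eq_bot.1 h)
    obtain ⟨v, rfl⟩ := hv
    refine ⟨((χ (Matrix.GeneralLinearGroup.det (g : GL (Fin n) F)) : kˣ) : k)⁻¹ • π₁ g v, ?_⟩
    rw [map_smul, hχ, inv_smul_smul₀ (Units.ne_zero _)]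
  refine ⟨.mk (LinearEquiv.ofBijective ψ
    ⟨LinearMap.ker_eq_bot.1 hker, LinearMap.range_eq_top.1 hrange⟩) fun g => ?_⟩
  ext v
  exact hχ g v


theorem linHom_apply_apply {G : Type*} [Group G] (π₁ : Representation k G V₁)
    (π₂ : Representation k G V₂) (g : G) (f : V₁ →ₗ[k] V₂) (v : V₁) :
    Representation.linHom π₁ π₂ g f v = π₂ g (f (π₁ g⁻¹ v)) := rfl

/-- The map is i₂ ∘ r₁, through V'. It is nonzero because r₂ ∘ i₂ ∘ r₁ ∘ i₁ is the identity of V' ≠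
0. -/
theorem exists_nonzero_intertwining {M : Subgroup (GL (Fin n) F)} {V' : Type*} [AddCommGroup V']
    [Module k V'] {π' : Representation k (prime M) V'} (h' : π'.IsIrreducible)
    {π₁ : Representation k M V₁} {π₂ : Representation k M V₂}
    (h₁ : IsDirectComponent π' (resPrime π₁)) (h₂ : IsDirectComponent π' (resPrime π₂)) :
    ∃ φ : V₁ →ₗ[k] V₂, φ ≠ 0 ∧ ∀ g : M,
      Matrix.GeneralLinearGroup.det (g : GL (Fin n) F) = 1 → ∀ v, φ (π₁ g v) = π₂ g (φ v) := by
  obtain ⟨i₁, r₁, hr₁⟩ := h₁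
  obtain ⟨i₂, r₂, hr₂⟩ := h₂
  have := irreducible_nontrivial h'
  obtain ⟨v, hv⟩ := exists_ne (0 : V')
  refine ⟨i₂.toLinearMap ∘ₗ r₁.toLinearMap, fun h0 => hv ?_, fun g hg w => ?_⟩
  · have h := LinearMap.congr_fun h0 (i₁ v)
    have h : i₂ (r₁ (i₁ v)) = 0 := h
    rw [hr₁] at h
    rw [← hr₂ v, h, map_zero]
  · let g' : prime M := ⟨g, g.2, hg⟩
    have e₁ : r₁ (π₁ g w) = π' g' (r₁ w) := Representation.IntertwiningMap.isIntertwining _ _ r₁ g' w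
    have e₂ : i₂ (π' g' (r₁ w)) = π₂ g (i₂ (r₁ w)) := 
      Representation.IntertwiningMap.isIntertwining _ _ i₂ g' (r₁ w)
    change i₂ (r₁ (π₁ g w)) = π₂ g (i₂ (r₁ w))
    rw [e₁, e₂]

variable [ValuativeRel F] [TopologicalSpace F] [IsNonarchimedeanLocalField F]

/-- A map equivariant for the elements of determinant one is fixed by a congruence subgroup. -/
theorem exists_leviCong_fix {t : Fˣ} (ht : ordVal F (t : F) = WithZero.exp (-1))
    {l : Cocharacter n F} (i₀ : Fin n) {π₁ : Representation k l.levi V₁}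
    {π₂ : Representation k l.levi V₂} (h₁ : π₁.IsIrreducible) (hsm₁ : IsSmooth π₁)
    (hsm₂ : IsSmooth π₂) {c : k}
    (hc : ∀ v, π₁ (blockCenter l t (Multiplicative.ofAdd fun _ => 1)) v = c • v)
    (φ : V₁ →ₗ[k] V₂) (hφ : ∀ g : l.levi,
      Matrix.GeneralLinearGroup.det (g : GL (Fin n) F) = 1 → ∀ v, φ (π₁ g v) = π₂ g (φ v)) :
    ∃ m, ∀ γ ∈ leviCong l m, Representation.linHom π₁ π₂ γ φ = φ := by
  have := irreducible_nontrivial h₁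
  obtain ⟨w, hw⟩ := exists_ne (0 : V₁)
  obtain ⟨m₀, hm₀⟩ := hsm₁.exists_leviCong w
  obtain ⟨S, hS, hrep⟩ := exists_finite_orbit_reps ht i₀ hm₀ hc
  choose a ha using fun s => hsm₁.exists_leviCong s
  choose b hb using fun s => hsm₂.exists_leviCong (φ s)
  -- The level makes γ fix both v and φ v for the finitely many representatives v of the orbit of w.
  refine ⟨hS.toFinset.sup fun s => max (a s) (b s), fun γ hγ => ?_⟩
  have hle : ∀ s ∈ S, max (a s) (b s) ≤ hS.toFinset.sup fun s => max (a s) (b s) := fun s hs =>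
    Finset.le_sup (f := fun s => max (a s) (b s)) (hS.mem_toFinset.2 hs)
  have htop : LinearMap.ker (Representation.linHom π₁ π₂ γ φ - φ) = ⊤ := by
    refine eq_top_of_orbit (irreducible_stable h₁) hw fun g => ?_
    obtain ⟨g', hg', s, v, hv, e⟩ := hrep g
    rw [e]
    refine Submodule.smul_mem _ _ ?_
    rw [LinearMap.mem_ker, LinearMap.sub_apply, sub_eq_zero, linHom_apply_apply, hφ g' hg']
    have h1 : π₁ γ⁻¹ v = v := ha v _ (inv_mem (leviCong_antitone l
      ((le_max_left _ _).trans (hle v hv)) hγ))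
    have h2 : π₂ γ (φ v) = φ v := hb v _ (leviCong_antitone l
      ((le_max_right _ _).trans (hle v hv)) hγ)
    -- As γ fixes v, moving γ⁻¹ past g' conjugates g', which keeps determinant one, so φ still
    -- commutes with the result.
    have h3 : π₁ γ⁻¹ (π₁ g' v) = π₁ (γ⁻¹ * g' * γ) v := by
      conv_rhs => rw [← h1]
      rw [← Module.End.mul_apply, ← map_mul, ← Module.End.mul_apply, ← map_mul]
      congr 2; group
    rw [h3, hφ _ (by simp [hg']), ← Module.End.mul_apply, ← map_mul]
    conv_rhs => rw [← h2]
    rw [← Module.End.mul_apply, ← map_mul]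
    congr 2; group
  exact sub_eq_zero.1 (LinearMap.ker_eq_top.1 htop)

/-- Two irreducible smooth representations of a Levi subgroup on which the centre acts by
scalars, linked by a nonzero map equivariant for determinant one, are twists of each other. -/
theorem exists_twist_of_scalar [IsAlgClosed k] {t : Fˣ}
    (ht : ordVal F (t : F) = WithZero.exp (-1))
    {l : Cocharacter n F} (i₀ : Fin n) {π₁ : Representation k l.levi V₁}
    {π₂ : Representation k l.levi V₂} (h₁ : π₁.IsIrreducible) (h₂ : π₂.IsIrreducible)
    (hsm₁ : IsSmooth π₁) (hsm₂ : IsSmooth π₂)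
    (hc₁ : ∀ z, ∃ c : k, ∀ v, π₁ (blockCenter l t z) v = c • v)
    (hc₂ : ∀ z, ∃ c : k, ∀ v, π₂ (blockCenter l t z) v = c • v)
    (φ : V₁ →ₗ[k] V₂) (hφ0 : φ ≠ 0) (hφ : ∀ g : l.levi,
      Matrix.GeneralLinearGroup.det (g : GL (Fin n) F) = 1 → ∀ v, φ (π₁ g v) = π₂ g (φ v)) :
    ∃ χ : Fˣ →* kˣ, IsQuasicharacter χ ∧ Nonempty (π₁.Equiv (twistDet π₂ χ)) := by
  obtain ⟨c₁, hc₁'⟩ := hc₁ (Multiplicative.ofAdd fun _ => 1)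
  obtain ⟨c₁i, hc₁i⟩ := hc₁ (Multiplicative.ofAdd fun _ => 1)⁻¹
  obtain ⟨c₂, hc₂'⟩ := hc₂ (Multiplicative.ofAdd fun _ => 1)
  obtain ⟨m, hm⟩ := exists_leviCong_fix ht i₀ h₁ hsm₁ hsm₂ hc₁' φ hφ
  set τ := Representation.linHom π₁ π₂ with hτ
  have hdet1 : ∀ g : l.levi, Matrix.GeneralLinearGroup.det (g : GL (Fin n) F) = 1 →
      τ g φ = φ := by
    intro g hg
    ext v
    rw [hτ, linHom_apply_apply, ← hφ g hg, ← Module.End.mul_apply, ← map_mul]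
    simp
  have hscal : ∀ f, τ (blockCenter l t (Multiplicative.ofAdd fun _ => 1)) f = (c₁i * c₂) • f := by
    intro f
    ext v
    rw [hτ, linHom_apply_apply, hc₂', ← map_inv, hc₁i, map_smul, smul_smul, LinearMap.smul_apply,
      mul_comm]
  -- On maps fixed by all elements of determinant one, τ depends only on the determinant, so it is
  -- commutative there and preserves X.
  let X : Submodule k (V₁ →ₗ[k] V₂) :=
    { carrier := {f | (∀ g : l.levi, Matrix.GeneralLinearGroup.det (g : GL (Fin n) F) = 1 →
        τ g f = f) ∧ ∀ γ ∈ leviCong l m, τ γ f = f}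
      zero_mem' := ⟨fun g _ => map_zero _, fun g _ => map_zero _⟩
      add_mem' := fun {a b} ha hb => ⟨fun g hg => by rw [map_add, ha.1 g hg, hb.1 g hg],
        fun g hg => by rw [map_add, ha.2 g hg, hb.2 g hg]⟩
      smul_mem' := fun c a ha => ⟨fun g hg => by rw [map_smul, ha.1 g hg],
        fun g hg => by rw [map_smul, ha.2 g hg]⟩ }
  have hφX : φ ∈ X := ⟨hdet1, hm⟩
  have hX1 : ∀ f ∈ X, ∀ g h : l.levi, Matrix.GeneralLinearGroup.det (g : GL (Fin n) F)
      = Matrix.GeneralLinearGroup.det (h : GL (Fin n) F) → τ g f = τ h f := by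
    intro f hf g h hgh
    have h1 := hf.1 (h⁻¹ * g) (by
      rw [Subgroup.coe_mul, Subgroup.coe_inv, map_mul, map_inv, hgh, inv_mul_cancel])
    conv_rhs => rw [← h1]
    rw [← Module.End.mul_apply, ← map_mul, mul_inv_cancel_left]
  have hcomm : ∀ f ∈ X, ∀ g h, τ g (τ h f) = τ h (τ g f) := by
    intro f hf g h
    rw [← Module.End.mul_apply, ← Module.End.mul_apply, ← map_mul, ← map_mul]
    refine hX1 f hf _ _ ?_
    rw [Subgroup.coe_mul, Subgroup.coe_mul, map_mul, map_mul, mul_comm]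
  have hXst : ∀ g, ∀ f ∈ X, τ g f ∈ X := fun g f hf =>
    ⟨fun h hh => by rw [hcomm f hf, hf.1 h hh], fun h hh => by rw [hcomm f hf, hf.2 h hh]⟩
  let Y₀ : Submodule k (V₁ →ₗ[k] V₂) := Submodule.span k (Set.range fun g => τ g φ)
  have hY₀X : Y₀ ≤ X := Submodule.span_le.2 (by rintro _ ⟨g, rfl⟩; exact hXst g φ hφX)
  have hY₀st : ∀ g, ∀ f ∈ Y₀, τ g f ∈ Y₀ := by
    intro g
    have : Y₀ ≤ Y₀.comap (τ g) := Submodule.span_le.2 (by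
      rintro _ ⟨h, rfl⟩
      exact Submodule.subset_span ⟨g * h, by simp⟩)
    exact this
  have hY₀ : Y₀ ≠ ⊥ := by
    intro h
    have h1 : φ ∈ Y₀ := Submodule.subset_span ⟨1, by simp⟩
    rw [h] at h1
    exact hφ0 h1
  -- The orbit lemma is applied to φ itself, as a vector of Hom(V₁, V₂) under τ.
  obtain ⟨S, hS, hrep⟩ := exists_finite_orbit_reps ht i₀ hm hscal
  have hfin : FiniteDimensional k Y₀ := by
    have := FiniteDimensional.span_of_finite k hS
    refine Submodule.finiteDimensional_of_le (S₂ := Submodule.span k S) (Submodule.span_le.2 ?_)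
    rintro _ ⟨g, rfl⟩
    obtain ⟨g', hg', s, v, hv, e⟩ := hrep g
    change τ g φ ∈ Submodule.span k S
    -- When s ≠ 0, the representative v comes from τ g φ by rescaling and applying g'⁻¹. So v lies
    -- in X and is fixed by g', and τ g φ is a multiple of v.
    by_cases hs : s = 0
    · rw [e, hs, zero_smul]; exact zero_mem _
    · have hvX : v ∈ X := by
        have h1 := hXst g'⁻¹ _ (X.smul_mem s⁻¹ (hXst g φ hφX))
        rw [e, inv_smul_smul₀ hs, ← Module.End.mul_apply, ← map_mul] at h1
        simpa using h1
      rw [e, hvX.1 g' hg']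
      exact Submodule.smul_mem _ _ (Submodule.subset_span hv)
  obtain ⟨ψ, hψY, hψ0, χ₀, hχ₀⟩ := exists_common_eigenvector τ Y₀ hY₀ hY₀st
    (fun g h f hf => hcomm f (hY₀X hf) g h)
  have hψX := hY₀X hψY
  -- The eigencharacter factors through the determinant, with `detSection` as section.
  have hχeq : ∀ g : l.levi,
      χ₀ (detSection l i₀ (Matrix.GeneralLinearGroup.det (g : GL (Fin n) F))) = χ₀ g := by
    intro g
    apply Units.ext
    apply smul_left_injective k hψ0
    change _ • ψ = _ • ψ
    rw [← hχ₀, ← hχ₀]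
    exact hX1 ψ hψX _ _ (det_detSection l i₀ _)
  -- The inverse appears because π₂(g) ψ π₁(g)⁻¹ = χ₀(g) ψ reads ψ π₁(g) = χ₀(g)⁻¹ π₂(g) ψ.
  refine ⟨(χ₀.comp (detSection l i₀))⁻¹, ?_,
    nonempty_equiv_twistDet h₁ h₂ _ ψ hψ0 fun g v => ?_⟩
  · refine Subgroup.isOpen_of_mem_nhds _ (g := 1) ?_
    have hopen : IsOpen {u : Fˣ | (u : F) - 1 ∈ fracIdeal F m ∧
        ((u⁻¹ : Fˣ) : F) - 1 ∈ fracIdeal F m} := by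
      refine IsOpen.inter ?_ ?_
      · exact (isOpen_fracIdeal (F := F) m).preimage (Units.continuous_val.sub continuous_const)
      · exact (isOpen_fracIdeal (F := F) m).preimage
          ((Units.continuous_val.comp continuous_inv).sub continuous_const)
    refine Filter.mem_of_superset (hopen.mem_nhds (by simp [zero_mem])) ?_
    rintro u ⟨hu, hu'⟩
    have h1 : χ₀ (detSection l i₀ u) = 1 := by
      apply Units.ext
      apply smul_left_injective k hψ0
      change _ • ψ = _ • ψ
      rw [← hχ₀, hψX.2 _ (detSection_mem_leviCong l i₀ hu hu'), Units.val_one, one_smul]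
    change (χ₀.comp (detSection l i₀))⁻¹ u = 1
    rw [MonoidHom.inv_apply, MonoidHom.comp_apply, h1, inv_one]
  · rw [MonoidHom.inv_apply, MonoidHom.comp_apply, hχeq]
    have h1 := LinearMap.congr_fun (hχ₀ g) (π₁ g v)
    rw [hτ, linHom_apply_apply, ← Module.End.mul_apply, ← map_mul, inv_mul_cancel, map_one,
      Module.End.one_apply, LinearMap.smul_apply] at h1
    rw [h1, smul_smul, Units.inv_mul, one_smul]

end Twist

end ModularSLn

theorem mainTheorem7
    {F : Type*} [Field F] [ValuativeRel F] [TopologicalSpace F] [IsNonarchimedeanLocalField F]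
    {k : Type*} [Field k] [IsAlgClosed k]
    (p ℓ : ℕ) [CharP (IsLocalRing.ResidueField (ValuativeRel.valuation F).integer) p]
    [CharP k ℓ] (hpℓ : ℓ ≠ p)
    (n : ℕ) (M : Subgroup (GL (Fin n) F)) (hM : ModularSLn.IsLeviSubgroup M)
    {V' V₁ V₂ : Type*} [AddCommGroup V'] [Module k V']
    [AddCommGroup V₁] [Module k V₁] [AddCommGroup V₂] [Module k V₂]
    (π' : Representation k (ModularSLn.prime M) V')
    (hπ'_irr : π'.IsIrreducible) (hπ'_smooth : ModularSLn.IsSmooth π')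
    (hπ'_cusp : ModularSLn.IsCuspidal π')
    (π₁ : Representation k M V₁)
    (hπ₁_irr : π₁.IsIrreducible) (hπ₁_smooth : ModularSLn.IsSmooth π₁)
    (hπ₁_cusp : ModularSLn.IsCuspidal π₁)
    (π₂ : Representation k M V₂)
    (hπ₂_irr : π₂.IsIrreducible) (hπ₂_smooth : ModularSLn.IsSmooth π₂)
    (hπ₂_cusp : ModularSLn.IsCuspidal π₂)
    (h₁ : ModularSLn.IsDirectComponent π' (ModularSLn.resPrime π₁))
    (h₂ : ModularSLn.IsDirectComponent π' (ModularSLn.resPrime π₂)) :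
    ∃ χ : Fˣ →* kˣ, ModularSLn.IsQuasicharacter χ ∧
      Nonempty (π₁.Equiv (ModularSLn.twistDet π₂ χ)) := by
  obtain ⟨l, rfl⟩ := hM
  obtain ⟨φ, hφ0, hφ⟩ := ModularSLn.exists_nonzero_intertwining hπ'_irr h₁ h₂
  -- In rank 0 there is no diagonal entry to carry a determinant; the group is trivial and φ is
  -- already an isomorphism.
  rcases n.eq_zero_or_pos with rfl | hn
  · refine ⟨1, ?_, ModularSLn.nonempty_equiv_twistDet hπ₁_irr hπ₂_irr 1 φ hφ0 fun g v => ?_⟩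
    · rw [ModularSLn.IsQuasicharacter, MonoidHom.ker_one]
      exact isOpen_univ
    · rw [hφ g (by rw [Subsingleton.elim (g : GL (Fin 0) F) 1, map_one])]
      simp
  · have hp := ModularSLn.residueChar_prime (F := F) p
    have hpF := ModularSLn.residueChar_mem_fracIdeal (F := F) p
    obtain ⟨t, ht⟩ := ModularSLn.exists_uniformizer (F := F)
    exact ModularSLn.exists_twist_of_scalar ht ⟨0, hn⟩ hπ₁_irr hπ₂_irr hπ₁_smooth hπ₂_smooth
      (hπ₁_cusp.exists_scalar_blockCenter hp hpF hpℓ ht hπ₁_irr hπ₁_smooth)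
      (hπ₂_cusp.exists_scalar_blockCenter hp hpF hpℓ ht hπ₂_irr hπ₂_smooth) φ hφ0 hφ
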